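/- **Setting.** Let $(\mathcal I,p)$ be a probability space of tasks. Each task $i$ is a Markov decision process with discrete state and action sets $\mathcal S_i,\mathcal A_i$, initial distribution $\mu_i$, transition probabilities $\mathcal P_i(s'|s,a)$ and rewards $r_i(s,a)\in[0,R]$; the horizon $H$ and the discount factor $\gamma\in(0,1)$ are common to all tasks. Let $\pi_i(a|s;w)>0$ be policies with parameter $w\in\mathbb R^d$. A trajectory $\tau=(s^0,a^0,\dots,a^{H-1},s^H)$ of task $i$ has probability $q_i(\tau;w)=\mu_i(s^0)\prod_{h<H}\pi_i(a^h|s^h;w)\prod_{h<H}\mathcal P_i(s^{h+1}|s^h,a^h)$. Put $$J_i(w)=\mathbb E_{\tau\sim q_i(\cdot;w)}\Big[\sum_{h<H}\gamma^h r_i(s^h,a^h)\Big],\qquad g_i(\tau;w)=\sum_{h<H}\nabla_w\log\pi_i(a^h|s^h;w)\sum_{l=h}^{H-1}\gamma^l r_i(s^l,a^l).$$ For $\lambda>0$ let $$V_i(w)=\max_{\theta\in\mathbb R^d}\Big[J_i(\theta)-\tfrac{\lambda}{2}\|\theta-w\|^2\Big],\qquad V(w)=\mathbb E_{i\sim p}[V_i(w)].$$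 **Assumption.** The maps $w\mapsto\log\pi_i(a|s;w)$ are twice differentiable, with $\|\nabla\log\pi_i(a|s;w)\|\le G$ and $\|\nabla^2\log\pi_i(a|s;w)\|\le L$ for all $i,s,a,w$. **Algorithm (MEMRL).** Parameters: $\lambda$, accuracy $\nu\ge 0$, step size $\alpha$, task batch size $B\ge1$, trajectory batch size $D\ge1$. Start from a (possibly random) $w^0$. In round $t$, given the history up to $w^t$, sample tasks $i_1,\dots,i_B$ independently from $p$, and for each $i=i_j$ let an inner solver (possibly randomized, independently over $j$) return $\tilde\theta_j$ that solves the inner problem to gradient accuracy $\nu$, in the following sense: almost surely, for a batch $\mathcal D=(\tau_1,\dots,\tau_D)$ of independent trajectories which, given $\tilde\theta_j$, are drawn from $q_i(\cdot;\tilde\theta_j)$, $$\mathbb E_{\mathcal D}\Big\|\tfrac1D\sum_{k=1}^D g_i(\tau_k;\tilde\theta_j)-\lambda(\tilde\theta_j-w^t)\Big\|^2\le\nu^2$$ (in particular it suffices that the norm is at most $\nu$ for almost every such batch). Then set $w^{t+1}=(1-\alpha\lambda)w^t+\frac{\alpha\lambda}{B}\sum_{j=1}^B\tilde\theta_j$.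 **Theorem (MEMRL convergence).** Let $\hat G=\frac{GR}{(1-\gamma)^2}$ and $\hat L=\frac{(HG^2+L)R}{(1-\gamma)^2}$. Let $\lambda>\hat L$, let $\kappa>1$ satisfy $\lambda\ge\kappa\hat L$, and let $\tilde L=\frac{\lambda}{\kappa-1}$. Let $T$ be an integer with $T\ge4\tilde L^2$, and let $\alpha=\frac1{2\sqrt T}$ (so that $\alpha\le\frac1{4\tilde L}$). Then the maxima defining the $V_i$ are attained, $V$ is differentiable, each $\|\nabla V(w^t)\|^2$ is integrable, and the iterates of the algorithm satisfy $$\frac1T\sum_{t=0}^{T-1}\mathbb E\|\nabla V(w^t)\|^2\le\frac{8R}{(1-\gamma)\sqrt T}+\frac{\lambda^2\nu^2}{(\lambda-\hat L)^2}+\frac{8\tilde L\hat G^2}{B\sqrt T}+\frac{8\tilde L\lambda^2\nu^2}{(\lambda-\hat L)^2B\sqrt T}+\frac{8\alpha\tilde L\lambda^2\hat G^2}{(\lambda-\hat L)^2BD\sqrt T}.$$ -/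

import Mathlib

open MeasureTheory ProbabilityTheory

/-- The parameter space `ℝ^d` with its Euclidean norm. -/
abbrev Param (d : ℕ) : Type := EuclideanSpace ℝ (Fin d)

/-- The dynamics of one task: initial state distribution, transition probabilities, rewards. -/
structure TaskMDP (S A : Type*) where
  /-- distribution of the initial state -/
  init : PMF S
  /-- `trans s a s'` is the probability of moving from `s` to `s'` under the action `a` -/
  trans : S → A → PMF S
  /-- reward of the action `a` in the state `s` -/
  reward : S → A → ℝ

/-- Trajectories `(s^0, a^0, …, a^{H-1}, s^H)`: the `H + 1` states and the `H` actions. -/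
abbrev Traj (S A : Type*) (H : ℕ) : Type _ := (Fin (H + 1) → S) × (Fin H → A)

/-- A multi-task reinforcement learning problem: a family of tasks with finite horizon `H`,
discount factor `γ`, and for every task a policy with parameter in `ℝ^d`. -/
structure MetaRL (d : ℕ) (I : Type*) (S A : I → Type*) where
  /-- horizon -/
  H : ℕ
  /-- discount factor -/
  γ : ℝ
  /-- the Markov decision process of each task -/
  mdp : ∀ i, TaskMDP (S i) (A i)
  /-- `policy i w s a` is the probability of the action `a` in the state `s` of the task `i` -/
  policy : ∀ i, Param d → S i → PMF (A i)

namespace MetaRL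

noncomputable section

variable {d : ℕ} {I : Type*} {S A : I → Type*} (X : MetaRL d I S A)

/-- `w ↦ log π_i(a | s; w)`. -/
def logPolicy (i : I) (s : S i) (a : A i) (w : Param d) : ℝ :=
  Real.log (X.policy i w s a).toReal

/-- The probability `q_i(τ; w)` of a trajectory. -/
def trajProb (i : I) (w : Param d) (τ : Traj (S i) (A i) X.H) : ℝ :=
  ((X.mdp i).init (τ.1 0)).toReal *
    (∏ h : Fin X.H, (X.policy i w (τ.1 h.castSucc) (τ.2 h)).toReal) *
    ∏ h : Fin X.H, ((X.mdp i).trans (τ.1 h.castSucc) (τ.2 h) (τ.1 h.succ)).toReal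

/-- The discounted reward `γ^h r_i(s^h, a^h)` collected at time `h`. -/
def discountedReward (i : I) (τ : Traj (S i) (A i) X.H) (h : Fin X.H) : ℝ :=
  X.γ ^ (h : ℕ) * (X.mdp i).reward (τ.1 h.castSucc) (τ.2 h)

/-- The value of a trajectory. -/
def trajReward (i : I) (τ : Traj (S i) (A i) X.H) : ℝ :=
  ∑ h : Fin X.H, X.discountedReward i τ h

/-- The part of the value of a trajectory collected from time `h` on. -/
def rewardFrom (i : I) (τ : Traj (S i) (A i) X.H) (h : Fin X.H) : ℝ :=
  ∑ l ∈ Finset.Ici h, X.discountedReward i τ l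

/-- The expected reward `J_i(w)`. -/
def J (i : I) (w : Param d) : ℝ :=
  ∑' τ : Traj (S i) (A i) X.H, X.trajProb i w τ * X.trajReward i τ

/-- The stochastic policy gradient `g_i(τ; w)`. -/
def policyGrad (i : I) (w : Param d) (τ : Traj (S i) (A i) X.H) : Param d :=
  ∑ h : Fin X.H, X.rewardFrom i τ h • gradient (X.logPolicy i (τ.1 h.castSucc) (τ.2 h)) w

/-- The stochastic policy gradient over a batch of `D` trajectories. -/
def batchGrad {D : ℕ} (i : I) (w : Param d) (𝒟 : Fin D → Traj (S i) (A i) X.H) : Param d :=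
  (D : ℝ)⁻¹ • ∑ k, X.policyGrad i w (𝒟 k)

/-- The stochastic gradient in `θ` of the inner problem with regularization `lam` at `w`. -/
def innerBatchGrad {D : ℕ} (lam : ℝ) (i : I) (w θ : Param d)
    (𝒟 : Fin D → Traj (S i) (A i) X.H) : Param d :=
  X.batchGrad i θ 𝒟 - lam • (θ - w)

/-- The mean square, over a batch of `D` independent trajectories drawn from `q_i(·; θ)`, of
the stochastic gradient of the inner problem at `θ`. -/
def innerError (D : ℕ) (lam : ℝ) (i : I) (w θ : Param d) : ℝ :=
  ∑' 𝒟 : Fin D → Traj (S i) (A i) X.H,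
    (∏ k, X.trajProb i θ (𝒟 k)) * ‖X.innerBatchGrad lam i w θ 𝒟‖ ^ 2

/-- The inner objective `θ ↦ J_i(θ) - (lam / 2) ‖θ - w‖²`. -/
def innerObjective (lam : ℝ) (i : I) (w θ : Param d) : ℝ :=
  X.J i θ - lam / 2 * ‖θ - w‖ ^ 2

/-- The Moreau envelope `V_i` of the expected reward of the task `i`. -/
def taskEnvelope (lam : ℝ) (i : I) (w : Param d) : ℝ :=
  ⨆ θ : Param d, X.innerObjective lam i w θ

/-- The meta-objective `V(w) = E_{i ∼ p} V_i(w)`. -/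
def metaObjective [MeasurableSpace I] (p : Measure I) (lam : ℝ) (w : Param d) : ℝ :=
  ∫ i, X.taskEnvelope lam i w ∂p

/-- All rewards lie in `[0, R]`. -/
def RewardsIn (R : ℝ) : Prop :=
  ∀ i s a, (X.mdp i).reward s a ∈ Set.Icc 0 R

/-- The log-policies are defined everywhere and twice differentiable in the parameter, with
gradients bounded by `G` and Hessians bounded by `L` in operator norm. -/
structure BoundedLogPolicy (G L : ℝ) : Prop where
  pos : ∀ i w s a, 0 < X.policy i w s a
  diff : ∀ i s a, Differentiable ℝ (X.logPolicy i s a)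
  diff_grad : ∀ i s a, Differentiable ℝ (gradient (X.logPolicy i s a))
  grad_le : ∀ i s a w, ‖gradient (X.logPolicy i s a) w‖ ≤ G
  hess_le : ∀ i s a w, ‖fderiv ℝ (gradient (X.logPolicy i s a)) w‖ ≤ L

/-- The constant `Ĝ = G R / (1 - γ)²`. -/
def gHat (G R : ℝ) : ℝ := G * R / (1 - X.γ) ^ 2

/-- The constant `L̂ = (H G² + L) R / (1 - γ)²`. -/
def lHat (G L R : ℝ) : ℝ := (X.H * G ^ 2 + L) * R / (1 - X.γ) ^ 2

/-- `w` is the random sequence of iterates of the algorithm with regularization `lam`, inner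
accuracy `ν`, step size `α`, task batch size `B` and trajectory batch size `D`. In round `t`,
`task t j` is the `j`-th sampled task and `θ t j` the inner solution computed for it; `ℱ t` is
the history before round `t`, including `w t`. -/
structure IsRun [MeasurableSpace I] (p : Measure I) (lam ν α : ℝ) (B D : ℕ)
    {Ω : Type*} [mΩ : MeasurableSpace Ω] (P : Measure Ω) (ℱ : Filtration ℕ mΩ)
    (w : ℕ → Ω → Param d) (task : ℕ → Fin B → Ω → I) (θ : ℕ → Fin B → Ω → Param d) :
    Prop where
  adapted : ∀ t, Measurable[ℱ t] (w t)
  measurable_task : ∀ t j, Measurable (task t j)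
  measurable_θ : ∀ t j, Measurable (θ t j)
  /-- Given the history, the `B` pairs of a task and an inner solution are independent; each
  task has law `p`, and the inner solution for a task `i` has the law `κ (ω, i)` given by some
  randomized inner solver, which may use the whole history. -/
  sampling : ∀ t, ∃ κ : @Kernel (Ω × I) (Param d) ((ℱ t).prod inferInstance) inferInstance,
    @IsMarkovKernel _ _ ((ℱ t).prod inferInstance) inferInstance κ ∧
    ∀ F : Set Ω, MeasurableSet[ℱ t] F →
    ∀ C : Fin B → Set (I × Param d), (∀ j, MeasurableSet (C j)) →
      P (F ∩ {ω | ∀ j, (task t j ω, θ t j ω) ∈ C j}) =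
        ∫⁻ ω in F, ∏ j, (∫⁻ i, κ (ω, i) {x | (i, x) ∈ C j} ∂p) ∂P
  /-- The stochastic gradient of the inner problem at `θ t j`, over a batch of `D` trajectories
  drawn from `q_i(·; θ t j)`, has norm at most `ν` in mean square. This is implied by, and
  weaker than, the norm being at most `ν` for almost every such batch. -/
  accurate : ∀ t j, ∀ᵐ ω ∂P, X.innerError D lam (task t j ω) (w t ω) (θ t j ω) ≤ ν ^ 2
  update : ∀ t ω, w (t + 1) ω =
    (1 - α * lam) • w t ω + (α * lam / B) • ∑ j, θ t j ω

end

end MetaRL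

/-! The update is stochastic gradient ascent on `V`. If `θ*` maximizes the inner objective of task
`i` at `w`, then `∇V_i(w) = λ(θ* - w)`, and `w^{t+1}` is `w^t` plus `α` times the mean of the
vectors `λ(θ̃_j - w^t)`, which are approximations of `∇V_{i_j}(w^t)`.

Smoothness of `J_i`. By causality, the mean reward at time `l` is unchanged when the policy is
frozen after time `l`. Differentiating it therefore produces only scores at times `h ≤ l`, and
summing over `l` gives `∇J_i = E g_i`, so `‖∇J_i‖ ≤ Ĝ`. One more differentiation bounds the
derivative of `∇J_i` by `HG·Ĝ + LR/(1-γ)² = L̂` (`hasGradientAt_J`, `norm_gradient_J_sub_le`).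

Smoothness of the envelope. Since `λ > L̂`, the vector field `θ ↦ ∇J_i(θ) - λ(θ - w)` controls the
distance to its zero with constant `λ - L̂` (`norm_sub_le_of_gradient_eq`). So `∇V_i` is Lipschitz
with constant `λL̂/(λ - L̂) ≤ L̃`. By Jensen the accuracy condition bounds this field by `ν` at
`θ̃_j`, whence `‖λ(θ̃_j - w) - ∇V_i(w)‖ ≤ δ := λν/(λ - L̂)`.

One step (`integral_norm_gradient_sq_le_of_step`). Let `u = ∇V(w^t)` and let `m` be the conditional
mean of the direction, so `‖m - u‖ ≤ δ`. Smoothness gives the gain `α⟪u, m⟫ - (L̃α²/2) E‖dir‖²` in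
expectation. Here `⟪u, m⟫ ≥ (‖u‖² + ‖m‖² - δ²)/2`, and conditional independence gives `E‖dir‖² ≤ (Ĝ
+ δ)²/B + E‖m‖²`; the `‖m‖²` terms cancel favourably because `αL̃ ≤ 1`. Since `0 ≤ V ≤ R/(1-γ)`,
telescoping finishes the proof. The trajectory batch enters only through Jensen, so the term with
`D` in the bound is pure slack. -/

/-! ### Trajectory weights and causality. -/

section Trajectories

open scoped ENNReal

/-- The weight of a trajectory under a time-dependent policy. -/
noncomputable def TaskMDP.pathWeight {S A : Type*} (M : TaskMDP S A) {H : ℕ}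
    (ρ : Fin H → S → PMF A) (τ : Traj S A H) : ℝ≥0∞ :=
  M.init (τ.1 0) * (∏ h : Fin H, ρ h (τ.1 h.castSucc) (τ.2 h)) *
    ∏ h : Fin H, M.trans (τ.1 h.castSucc) (τ.2 h) (τ.1 h.succ)

/-- Splitting off the last action and the last state of a trajectory. -/
def trajSnocEquiv (S A : Type*) (H : ℕ) : Traj S A H × (A × S) ≃ Traj S A (H + 1) where
  toFun x := (Fin.snoc x.1.1 x.2.2, Fin.snoc x.1.2 x.2.1)
  invFun τ := ((Fin.init τ.1, Fin.init τ.2), (τ.2 (Fin.last H), τ.1 (Fin.last (H + 1))))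
  left_inv x := by simp
  right_inv τ := by simp

variable {S A : Type*} (M : TaskMDP S A)

theorem TaskMDP.pathWeight_snoc {H : ℕ} (ρ : Fin (H + 1) → S → PMF A) (σ : Traj S A H)
    (a : A) (s : S) :
    M.pathWeight ρ (trajSnocEquiv S A H (σ, (a, s))) =
      M.pathWeight (fun h => ρ h.castSucc) σ *
        (ρ (Fin.last H) (σ.1 (Fin.last H)) a * M.trans (σ.1 (Fin.last H)) a s) := by
  have h0 : (Fin.snoc σ.1 s : Fin (H + 2) → S) 0 = σ.1 0 := by
    rw [← Fin.castSucc_zero, Fin.snoc_castSucc (α := fun _ => S)]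
  have h1 : (Fin.snoc σ.1 s : Fin (H + 2) → S) (Fin.last H).castSucc = σ.1 (Fin.last H) :=
    Fin.snoc_castSucc (α := fun _ => S) ..
  have h2 : (Fin.snoc σ.1 s : Fin (H + 2) → S) (Fin.last H).succ = s := by
    rw [Fin.succ_last, Fin.snoc_last]
  have h3 (h : Fin H) : (Fin.snoc σ.1 s : Fin (H + 2) → S) h.castSucc.castSucc = σ.1 h.castSucc :=
    Fin.snoc_castSucc (α := fun _ => S) ..
  have h4 (h : Fin H) : (Fin.snoc σ.1 s : Fin (H + 2) → S) h.castSucc.succ = σ.1 h.succ := by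
    rw [Fin.succ_castSucc]
    exact Fin.snoc_castSucc (α := fun _ => S) ..
  simp only [pathWeight, trajSnocEquiv, Equiv.coe_fn_mk, Fin.prod_univ_castSucc, h0, h1, h2, h3, h4,
    Fin.snoc_last, Fin.snoc_castSucc (α := fun _ => A)]
  ring

/-- If `φ` ignores the last action and the last state, these can be summed out: first the state,
then the action, each against a probability mass function. This is the induction step for total mass
and for causality. -/
theorem TaskMDP.tsum_pathWeight_snoc {H : ℕ} (ρ : Fin (H + 1) → S → PMF A)
    (φ : Traj S A (H + 1) → ℝ≥0∞) (ψ : Traj S A H → ℝ≥0∞)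
    (h : ∀ σ x, φ (trajSnocEquiv S A H (σ, x)) = ψ σ) :
    ∑' τ, M.pathWeight ρ τ * φ τ = ∑' σ, M.pathWeight (fun h => ρ h.castSucc) σ * ψ σ := by
  rw [← (trajSnocEquiv S A H).tsum_eq, ENNReal.tsum_prod']
  refine tsum_congr fun σ => ?_
  rw [ENNReal.tsum_prod']
  simp only [pathWeight_snoc, h]
  calc ∑' (a : A) (s : S), M.pathWeight (fun h => ρ h.castSucc) σ *
          (ρ (Fin.last H) (σ.1 (Fin.last H)) a * M.trans (σ.1 (Fin.last H)) a s) * ψ σ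
      = ∑' (a : A) (s : S), M.pathWeight (fun h => ρ h.castSucc) σ * ψ σ *
          (ρ (Fin.last H) (σ.1 (Fin.last H)) a * M.trans (σ.1 (Fin.last H)) a s) := by
        simp only [mul_right_comm]
    _ = _ := by simp only [ENNReal.tsum_mul_left, PMF.tsum_coe, mul_one]

theorem TaskMDP.tsum_pathWeight {H : ℕ} (ρ : Fin H → S → PMF A) :
    ∑' τ, M.pathWeight ρ τ = 1 := by
  induction H with
  | zero =>
    let e : S ≃ Traj S A 0 :=
      { toFun := fun s => (fun _ => s, Fin.elim0)
        invFun := fun τ => τ.1 0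
        left_inv := fun s => rfl
        right_inv := fun τ => Prod.ext (funext fun i => by
          have hi : i = 0 := Fin.ext (by simp)
          rw [hi])
          (Subsingleton.elim _ _) }
    rw [← e.tsum_eq]
    simp [pathWeight, e, PMF.tsum_coe]
  | succ H ih =>
    have := M.tsum_pathWeight_snoc ρ (fun _ => 1) (fun _ => 1) (fun _ _ => rfl)
    simp only [mul_one] at this
    rw [this, ih]

/-- Causality: the mean of a quantity that depends on the trajectory up to the `l`-th action
only does not depend on the policy used from time `l` on. -/
theorem TaskMDP.tsum_pathWeight_mul_congr {H : ℕ} (l : ℕ) (ρ ρ' : Fin H → S → PMF A)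
    (hρ : ∀ h : Fin H, (h : ℕ) < l → ρ h = ρ' h) (φ : Traj S A H → ℝ≥0∞)
    (hφ : ∀ τ τ' : Traj S A H, (∀ h : Fin H, (h : ℕ) < l →
      τ.1 h.castSucc = τ'.1 h.castSucc ∧ τ.2 h = τ'.2 h) → φ τ = φ τ') :
    ∑' τ, M.pathWeight ρ τ * φ τ = ∑' τ, M.pathWeight ρ' τ * φ τ := by
  induction H with
  | zero => rw [Subsingleton.elim ρ ρ']
  | succ H ih =>
    rcases le_or_gt (H + 1) l with hl | hl
    · rw [show ρ = ρ' from funext fun h => hρ h (h.2.trans_le hl)]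
    -- Here `l ≤ H`, so `φ` does not see the last step. The dummy pair `(a₀, s₀)` turns `φ` into a
    -- function of the shorter trajectory, to which induction applies.
    · obtain ⟨s₀, -⟩ := M.init.support_nonempty
      obtain ⟨a₀, -⟩ := (ρ 0 s₀).support_nonempty
      have key (σ x) : φ (trajSnocEquiv S A H (σ, x)) = φ (trajSnocEquiv S A H (σ, (a₀, s₀))) := by
        refine hφ _ _ fun h hh => ?_
        have hH : (h : ℕ) < H := by omega
        obtain ⟨h, rfl⟩ : ∃ k : Fin H, h = k.castSucc := ⟨⟨h, hH⟩, rfl⟩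
        exact ⟨by simp [trajSnocEquiv, Fin.snoc_castSucc (α := fun _ => S)],
          by simp [trajSnocEquiv, Fin.snoc_castSucc (α := fun _ => A)]⟩
      rw [M.tsum_pathWeight_snoc ρ φ _ key, M.tsum_pathWeight_snoc ρ' φ _ key]
      refine ih _ _ (fun h hh => hρ _ hh) _ fun τ τ' hττ => hφ _ _ fun h hh => ?_
      have hH : (h : ℕ) < H := by omega
      obtain ⟨h, rfl⟩ : ∃ k : Fin H, h = k.castSucc := ⟨⟨h, hH⟩, rfl⟩
      have := hττ h hh
      constructor
      · simpa [trajSnocEquiv, Fin.snoc_castSucc (α := fun _ => S)] using this.1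
      · simpa [trajSnocEquiv, Fin.snoc_castSucc (α := fun _ => A)] using this.2

theorem TaskMDP.pathWeight_ne_top {H : ℕ} (ρ : Fin H → S → PMF A) (τ : Traj S A H) :
    M.pathWeight ρ τ ≠ ⊤ :=
  ENNReal.ne_top_of_tsum_ne_top (by rw [M.tsum_pathWeight ρ]; exact ENNReal.one_ne_top) τ

theorem TaskMDP.hasSum_toReal_pathWeight {H : ℕ} (ρ : Fin H → S → PMF A) :
    HasSum (fun τ => (M.pathWeight ρ τ).toReal) 1 := by
  have := ENNReal.hasSum_toReal (f := M.pathWeight ρ)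
    (by rw [M.tsum_pathWeight ρ]; exact ENNReal.one_ne_top)
  rwa [← ENNReal.tsum_toReal_eq (M.pathWeight_ne_top ρ), M.tsum_pathWeight ρ,
    ENNReal.toReal_one] at this

/-- For `φ ≥ 0` the real series is the `toReal` of one in `ℝ≥0∞`, so causality transfers without any
summability assumption. -/
theorem TaskMDP.tsum_toReal_pathWeight_mul_congr {H : ℕ} (l : ℕ) (ρ ρ' : Fin H → S → PMF A)
    (hρ : ∀ h : Fin H, (h : ℕ) < l → ρ h = ρ' h) (φ : Traj S A H → ℝ) (hφ0 : ∀ τ, 0 ≤ φ τ)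
    (hφ : ∀ τ τ' : Traj S A H, (∀ h : Fin H, (h : ℕ) < l →
      τ.1 h.castSucc = τ'.1 h.castSucc ∧ τ.2 h = τ'.2 h) → φ τ = φ τ') :
    ∑' τ, (M.pathWeight ρ τ).toReal * φ τ = ∑' τ, (M.pathWeight ρ' τ).toReal * φ τ := by
  have key (ρ : Fin H → S → PMF A) : ∑' τ, (M.pathWeight ρ τ).toReal * φ τ =
      (∑' τ, M.pathWeight ρ τ * ENNReal.ofReal (φ τ)).toReal := by
    rw [ENNReal.tsum_toReal_eq
      fun τ => ENNReal.mul_ne_top (M.pathWeight_ne_top ρ τ) ENNReal.ofReal_ne_top]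
    exact tsum_congr fun τ => by rw [ENNReal.toReal_mul, ENNReal.toReal_ofReal (hφ0 τ)]
  rw [key, key, M.tsum_pathWeight_mul_congr l ρ ρ' hρ _ fun τ τ' h => by rw [hφ τ τ' h]]

end Trajectories

/-! ### Termwise differentiation of weighted series. -/

section SeriesOfExponentials

variable {ι E F : Type*} [NormedAddCommGroup E] [NormedSpace ℝ E] [NormedAddCommGroup F]
  [NormedSpace ℝ F]

theorem summable_smul_of_bounded [CompleteSpace F] {q : ι → ℝ} {x : ι → F} {C : ℝ}
    (hq0 : ∀ i, 0 ≤ q i) (hq : Summable q) (hx : ∀ i, ‖x i‖ ≤ C) :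
    Summable fun i => q i • x i := by
  refine Summable.of_norm_bounded (hq.mul_right C) fun i => ?_
  rw [norm_smul, Real.norm_of_nonneg (hq0 i)]
  exact mul_le_mul_of_nonneg_left (hx i) (hq0 i)

theorem norm_tsum_smul_le {q : ι → ℝ} {x : ι → F} {C : ℝ}
    (hq0 : ∀ i, 0 ≤ q i) (hq : HasSum q 1) (hx : ∀ i, ‖x i‖ ≤ C) :
    ‖∑' i, q i • x i‖ ≤ C := by
  refine tsum_of_norm_bounded (by simpa using hq.mul_right C) fun i => ?_
  rw [norm_smul, Real.norm_of_nonneg (hq0 i)]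
  exact mul_le_mul_of_nonneg_left (hx i) (hq0 i)

/-- Differentiation of a series of exponentials with uniformly bounded logarithmic derivatives. -/
theorem hasFDerivAt_tsum_exp_smul [CompleteSpace F] {c : ι → ℝ} (hc : ∀ i, 0 ≤ c i)
    {ℓ : ι → E → ℝ} {ℓ' : ι → E → E →L[ℝ] ℝ} {v : ι → E → F} {v' : ι → E → E →L[ℝ] F}
    {K M N : ℝ} (hℓ : ∀ i w, HasFDerivAt (ℓ i) (ℓ' i w) w) (hK : ∀ i w, ‖ℓ' i w‖ ≤ K)
    (hv : ∀ i w, HasFDerivAt (v i) (v' i w) w) (hM : ∀ i w, ‖v i w‖ ≤ M)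
    (hN : ∀ i w, ‖v' i w‖ ≤ N) (hs : ∀ w, Summable fun i => c i * Real.exp (ℓ i w)) (w : E) :
    HasFDerivAt (fun w => ∑' i, (c i * Real.exp (ℓ i w)) • v i w)
      (∑' i, (c i * Real.exp (ℓ i w)) • ((ℓ' i w).smulRight (v i w) + v' i w)) w := by
  rcases isEmpty_or_nonempty ι with hι | ⟨⟨i₀⟩⟩
  · simp only [tsum_empty]
    exact hasFDerivAt_const _ _
  have hK0 : 0 ≤ K := (norm_nonneg _).trans (hK i₀ w)
  have hM0 : 0 ≤ M := (norm_nonneg _).trans (hM i₀ w)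
  have hN0 : 0 ≤ N := (norm_nonneg _).trans (hN i₀ w)
  have hD (i : ι) (x : E) : HasFDerivAt (fun w => (c i * Real.exp (ℓ i w)) • v i w)
      ((c i * Real.exp (ℓ i x)) • ((ℓ' i x).smulRight (v i x) + v' i x)) x := by
    refine (((hℓ i x).exp.const_mul (c i)).smul (hv i x)).congr_fderiv ?_
    ext y
    simp only [_root_.add_apply, _root_.smul_apply,
      ContinuousLinearMap.smulRight_apply, smul_eq_mul, smul_add, smul_smul]
    rw [add_comm, mul_assoc]
  have hb (i : ι) (x : E) : ‖(ℓ' i x).smulRight (v i x) + v' i x‖ ≤ K * M + N := by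
    refine (norm_add_le _ _).trans (add_le_add ?_ (hN i x))
    rw [ContinuousLinearMap.norm_smulRight_apply]
    exact mul_le_mul (hK i x) (hM i x) (norm_nonneg _) hK0
  -- Each `ℓ i` is `K`-Lipschitz, so on the unit ball a weight exceeds its value at the centre by a
  -- factor of at most `exp K`. This gives a summable majorant of the derivatives.
  have hexp (i : ι) (x : E) (hx : x ∈ Metric.ball w 1) :
      c i * Real.exp (ℓ i x) ≤ c i * Real.exp (ℓ i w) * Real.exp K := by
    rw [mul_assoc, ← Real.exp_add]
    refine mul_le_mul_of_nonneg_left (Real.exp_le_exp.2 ?_) (hc i)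
    have h1 := Convex.norm_image_sub_le_of_norm_hasFDerivWithin_le (𝕜 := ℝ) (f := ℓ i)
      (f' := ℓ' i) (s := Set.univ) (C := K) (fun y _ => (hℓ i y).hasFDerivWithinAt)
      (fun y _ => hK i y) convex_univ (Set.mem_univ w) (Set.mem_univ x)
    have h2 : K * ‖x - w‖ ≤ K * 1 :=
      mul_le_mul_of_nonneg_left (mem_ball_iff_norm.1 hx).le hK0
    linarith [Real.le_norm_self (ℓ i x - ℓ i w)]
  refine hasFDerivAt_tsum_of_isPreconnected
    (u := fun i => c i * Real.exp (ℓ i w) * Real.exp K * (K * M + N))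
    (((hs w).mul_right _).mul_right _) Metric.isOpen_ball
    (convex_ball w 1).isPreconnected (fun i x _ => hD i x) (fun i x hx => ?_)
    (Metric.mem_ball_self one_pos)
    (summable_smul_of_bounded (fun i => mul_nonneg (hc i) (Real.exp_pos _).le) (hs w)
      fun i => hM i w) (Metric.mem_ball_self one_pos)
  rw [norm_smul, Real.norm_of_nonneg (mul_nonneg (hc i) (Real.exp_pos _).le)]
  exact mul_le_mul (hexp i x hx) (hb i x) (norm_nonneg _)
    (mul_nonneg (mul_nonneg (hc i) (Real.exp_pos _).le) (Real.exp_pos _).le)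

end SeriesOfExponentials

/-! ### Policy gradient theorem and smoothness of `J`. -/

namespace MetaRL

variable {d : ℕ} {I : Type*} {S A : I → Type*} (X : MetaRL d I S A)

theorem trajProb_eq_toReal_pathWeight (i : I) (w : Param d) (τ : Traj (S i) (A i) X.H) :
    X.trajProb i w τ = ((X.mdp i).pathWeight (fun _ => X.policy i w) τ).toReal := by
  simp only [trajProb, TaskMDP.pathWeight, ENNReal.toReal_mul, ENNReal.toReal_prod]

theorem trajProb_nonneg (i : I) (w : Param d) (τ : Traj (S i) (A i) X.H) :
    0 ≤ X.trajProb i w τ := by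
  rw [trajProb_eq_toReal_pathWeight]; exact ENNReal.toReal_nonneg

theorem hasSum_trajProb (i : I) (w : Param d) : HasSum (X.trajProb i w) 1 := by
  simp only [funext (X.trajProb_eq_toReal_pathWeight i w)]
  exact (X.mdp i).hasSum_toReal_pathWeight _

/-- The policy used at time `h` when the parameter is `w` at the times in `s` and `w₀` at the
other times. -/
noncomputable def mixedPolicy (i : I) (s : Finset (Fin X.H)) (w₀ w : Param d) (h : Fin X.H) :
    S i → PMF (A i) :=
  X.policy i (if h ∈ s then w else w₀)

theorem mixedPolicy_self (i : I) (s : Finset (Fin X.H)) (w : Param d) :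
    X.mixedPolicy i s w w = fun _ => X.policy i w := by
  funext h
  simp only [mixedPolicy, ite_self]

/-- The part of the trajectory weight under `mixedPolicy` that does not depend on `w`. -/
noncomputable def frozenWeight (i : I) (s : Finset (Fin X.H)) (w₀ : Param d)
    (τ : Traj (S i) (A i) X.H) : ℝ :=
  ((X.mdp i).init (τ.1 0)).toReal *
    (∏ h ∈ Finset.univ.filter (· ∉ s), (X.policy i w₀ (τ.1 h.castSucc) (τ.2 h)).toReal) *
    ∏ h : Fin X.H, ((X.mdp i).trans (τ.1 h.castSucc) (τ.2 h) (τ.1 h.succ)).toReal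

variable {X} {R G L : ℝ}

theorem BoundedLogPolicy.exp_logPolicy (hGL : X.BoundedLogPolicy G L) (i : I) (s : S i) (a : A i)
    (w : Param d) : Real.exp (X.logPolicy i s a w) = (X.policy i w s a).toReal :=
  Real.exp_log (ENNReal.toReal_pos (hGL.pos i w s a).ne' (PMF.apply_ne_top _ _))

/-- This isolates the dependence on `w` in an exponential, the shape needed by
`hasFDerivAt_tsum_exp_smul`. -/
theorem BoundedLogPolicy.toReal_pathWeight_mixedPolicy (hGL : X.BoundedLogPolicy G L) (i : I)
    (s : Finset (Fin X.H)) (w₀ w : Param d) (τ : Traj (S i) (A i) X.H) :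
    ((X.mdp i).pathWeight (X.mixedPolicy i s w₀ w) τ).toReal =
      X.frozenWeight i s w₀ τ *
        Real.exp (∑ h ∈ s, X.logPolicy i (τ.1 h.castSucc) (τ.2 h) w) := by
  have h1 : ∏ h : Fin X.H, (X.mixedPolicy i s w₀ w h (τ.1 h.castSucc) (τ.2 h)).toReal =
      (∏ h ∈ s, (X.policy i w (τ.1 h.castSucc) (τ.2 h)).toReal) *
      ∏ h ∈ Finset.univ.filter (· ∉ s), (X.policy i w₀ (τ.1 h.castSucc) (τ.2 h)).toReal := by
    rw [← Finset.prod_filter_mul_prod_filter_not Finset.univ (· ∈ s)]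
    congr 1
    · rw [Finset.filter_mem_eq_inter, Finset.univ_inter]
      exact Finset.prod_congr rfl fun h hh => by simp [mixedPolicy, hh]
    · refine Finset.prod_congr rfl fun h hh => ?_
      simp [mixedPolicy, (Finset.mem_filter.1 hh).2]
  simp only [TaskMDP.pathWeight, ENNReal.toReal_mul, ENNReal.toReal_prod, h1, frozenWeight,
    Real.exp_sum, hGL.exp_logPolicy]
  ring

theorem frozenWeight_nonneg (i : I) (s : Finset (Fin X.H)) (w₀ : Param d)
    (τ : Traj (S i) (A i) X.H) : 0 ≤ X.frozenWeight i s w₀ τ :=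
  mul_nonneg (mul_nonneg ENNReal.toReal_nonneg (Finset.prod_nonneg fun _ _ => ENNReal.toReal_nonneg))
    (Finset.prod_nonneg fun _ _ => ENNReal.toReal_nonneg)

theorem RewardsIn.nonneg (hR : X.RewardsIn R) (i : I) : 0 ≤ R := by
  obtain ⟨s, -⟩ := (X.mdp i).init.support_nonempty
  obtain ⟨a, -⟩ := (X.policy i 0 s).support_nonempty
  exact (hR i s a).1.trans (hR i s a).2

theorem BoundedLogPolicy.nonneg (hGL : X.BoundedLogPolicy G L) (i : I) : 0 ≤ G ∧ 0 ≤ L := by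
  obtain ⟨s, -⟩ := (X.mdp i).init.support_nonempty
  obtain ⟨a, -⟩ := (X.policy i 0 s).support_nonempty
  exact ⟨(norm_nonneg _).trans (hGL.grad_le i s a 0), (norm_nonneg _).trans (hGL.hess_le i s a 0)⟩

theorem RewardsIn.discountedReward_nonneg (hR : X.RewardsIn R) (hγ : X.γ ∈ Set.Ioo (0 : ℝ) 1)
    (i : I) (τ : Traj (S i) (A i) X.H) (h : Fin X.H) : 0 ≤ X.discountedReward i τ h :=
  mul_nonneg (pow_nonneg hγ.1.le _) (hR i _ _).1

theorem RewardsIn.discountedReward_le (hR : X.RewardsIn R) (hγ : X.γ ∈ Set.Ioo (0 : ℝ) 1)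
    (i : I) (τ : Traj (S i) (A i) X.H) (h : Fin X.H) :
    X.discountedReward i τ h ≤ X.γ ^ (h : ℕ) * R :=
  mul_le_mul_of_nonneg_left (hR i _ _).2 (pow_nonneg hγ.1.le _)

theorem RewardsIn.rewardFrom_nonneg (hR : X.RewardsIn R) (hγ : X.γ ∈ Set.Ioo (0 : ℝ) 1)
    (i : I) (τ : Traj (S i) (A i) X.H) (h : Fin X.H) : 0 ≤ X.rewardFrom i τ h :=
  Finset.sum_nonneg fun l _ => hR.discountedReward_nonneg hγ i τ l

/-- A geometric tail. Keeping the factor `γ ^ h` lets the later sum over `h` cost another `1 / (1 -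
γ)` instead of `H`. -/
theorem RewardsIn.rewardFrom_le (hR : X.RewardsIn R) (hγ : X.γ ∈ Set.Ioo (0 : ℝ) 1)
    (i : I) (τ : Traj (S i) (A i) X.H) (h : Fin X.H) :
    X.rewardFrom i τ h ≤ X.γ ^ (h : ℕ) / (1 - X.γ) * R := by
  calc X.rewardFrom i τ h ≤ ∑ l ∈ Finset.Ici h, X.γ ^ (l : ℕ) * R :=
        Finset.sum_le_sum fun l _ => hR.discountedReward_le hγ i τ l
    _ = (∑ l ∈ Finset.Ico (h : ℕ) X.H, X.γ ^ l) * R := by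
        rw [← Finset.sum_mul, ← Fin.map_valEmbedding_Ici, Finset.sum_map]
        simp
    _ ≤ _ := mul_le_mul_of_nonneg_right (geom_sum_Ico_le_of_lt_one hγ.1.le hγ.2) (hR.nonneg i)

theorem sum_pow_le (hγ : X.γ ∈ Set.Ioo (0 : ℝ) 1) :
    ∑ h : Fin X.H, X.γ ^ (h : ℕ) ≤ 1 / (1 - X.γ) := by
  rw [Fin.sum_univ_eq_sum_range (fun h => X.γ ^ h), ← Nat.Ico_zero_eq_range]
  simpa using geom_sum_Ico_le_of_lt_one (m := 0) (n := X.H) hγ.1.le hγ.2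

theorem RewardsIn.sum_rewardFrom_le (hR : X.RewardsIn R) (hγ : X.γ ∈ Set.Ioo (0 : ℝ) 1)
    (i : I) (τ : Traj (S i) (A i) X.H) :
    ∑ h, X.rewardFrom i τ h ≤ R / (1 - X.γ) ^ 2 := by
  have h1 : 0 < 1 - X.γ := sub_pos.2 hγ.2
  calc ∑ h, X.rewardFrom i τ h ≤ ∑ h : Fin X.H, X.γ ^ (h : ℕ) / (1 - X.γ) * R :=
        Finset.sum_le_sum fun h _ => hR.rewardFrom_le hγ i τ h
    _ = (∑ h : Fin X.H, X.γ ^ (h : ℕ)) * (R / (1 - X.γ)) := by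
        rw [Finset.sum_mul]; exact Finset.sum_congr rfl fun _ _ => by ring
    _ ≤ 1 / (1 - X.γ) * (R / (1 - X.γ)) :=
        mul_le_mul_of_nonneg_right (sum_pow_le hγ) (div_nonneg (hR.nonneg i) h1.le)
    _ = _ := by field_simp

theorem RewardsIn.trajReward_nonneg (hR : X.RewardsIn R) (hγ : X.γ ∈ Set.Ioo (0 : ℝ) 1)
    (i : I) (τ : Traj (S i) (A i) X.H) : 0 ≤ X.trajReward i τ :=
  Finset.sum_nonneg fun l _ => hR.discountedReward_nonneg hγ i τ l

theorem RewardsIn.trajReward_le (hR : X.RewardsIn R) (hγ : X.γ ∈ Set.Ioo (0 : ℝ) 1)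
    (i : I) (τ : Traj (S i) (A i) X.H) : X.trajReward i τ ≤ R / (1 - X.γ) := by
  calc X.trajReward i τ ≤ ∑ h : Fin X.H, X.γ ^ (h : ℕ) * R :=
        Finset.sum_le_sum fun h _ => hR.discountedReward_le hγ i τ h
    _ = (∑ h : Fin X.H, X.γ ^ (h : ℕ)) * R := by rw [Finset.sum_mul]
    _ ≤ 1 / (1 - X.γ) * R := mul_le_mul_of_nonneg_right (sum_pow_le hγ) (hR.nonneg i)
    _ = _ := by ring

theorem RewardsIn.J_nonneg (hR : X.RewardsIn R) (hγ : X.γ ∈ Set.Ioo (0 : ℝ) 1)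
    (i : I) (w : Param d) : 0 ≤ X.J i w :=
  tsum_nonneg fun τ => mul_nonneg (X.trajProb_nonneg i w τ) (hR.trajReward_nonneg hγ i τ)

theorem RewardsIn.J_le (hR : X.RewardsIn R) (hγ : X.γ ∈ Set.Ioo (0 : ℝ) 1)
    (i : I) (w : Param d) : X.J i w ≤ R / (1 - X.γ) :=
  (Real.le_norm_self _).trans <| norm_tsum_smul_le (X.trajProb_nonneg i w) (X.hasSum_trajProb i w)
    fun τ => by
      rw [Real.norm_of_nonneg (hR.trajReward_nonneg hγ i τ)]; exact hR.trajReward_le hγ i τ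

theorem norm_policyGrad_le (hγ : X.γ ∈ Set.Ioo (0 : ℝ) 1) (hR : X.RewardsIn R)
    (hGL : X.BoundedLogPolicy G L) (i : I) (w : Param d) (τ : Traj (S i) (A i) X.H) :
    ‖X.policyGrad i w τ‖ ≤ X.gHat G R := by
  calc ‖X.policyGrad i w τ‖ ≤ ∑ h, X.rewardFrom i τ h * G := by
        refine norm_sum_le_of_le _ fun h _ => ?_
        rw [norm_smul, Real.norm_of_nonneg (hR.rewardFrom_nonneg hγ i τ h)]
        exact mul_le_mul_of_nonneg_left (hGL.grad_le ..) (hR.rewardFrom_nonneg hγ i τ h)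
    _ = (∑ h, X.rewardFrom i τ h) * G := by rw [Finset.sum_mul]
    _ ≤ R / (1 - X.γ) ^ 2 * G :=
        mul_le_mul_of_nonneg_right (hR.sum_rewardFrom_le hγ i τ) (hGL.nonneg i).1
    _ = _ := by rw [gHat]; ring

theorem summable_trajProb_smul_policyGrad (hγ : X.γ ∈ Set.Ioo (0 : ℝ) 1) (hR : X.RewardsIn R)
    (hGL : X.BoundedLogPolicy G L) (i : I) (w : Param d) :
    Summable fun τ => X.trajProb i w τ • X.policyGrad i w τ :=
  summable_smul_of_bounded (X.trajProb_nonneg i w) (X.hasSum_trajProb i w).summable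
    (norm_policyGrad_le hγ hR hGL i w)

theorem BoundedLogPolicy.hasFDerivAt_sum (hGL : X.BoundedLogPolicy G L) (i : I)
    (s : Finset (Fin X.H)) (τ : Traj (S i) (A i) X.H) (w : Param d) :
    HasFDerivAt (fun w => ∑ h ∈ s, X.logPolicy i (τ.1 h.castSucc) (τ.2 h) w)
      (InnerProductSpace.toDual ℝ (Param d)
        (∑ h ∈ s, gradient (X.logPolicy i (τ.1 h.castSucc) (τ.2 h)) w)) w := by
  rw [map_sum]
  exact HasFDerivAt.fun_sum fun h _ => (hGL.diff i _ _ w).hasGradientAt.hasFDerivAt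

theorem BoundedLogPolicy.norm_sum_gradient_le (hGL : X.BoundedLogPolicy G L) (i : I)
    (s : Finset (Fin X.H)) (τ : Traj (S i) (A i) X.H) (w : Param d) :
    ‖InnerProductSpace.toDual ℝ (Param d)
        (∑ h ∈ s, gradient (X.logPolicy i (τ.1 h.castSucc) (τ.2 h)) w)‖ ≤ X.H * G := by
  rw [LinearIsometryEquiv.norm_map]
  calc _ ≤ ∑ h ∈ s, G := norm_sum_le_of_le _ fun h _ => hGL.grad_le ..
    _ = (s.card : ℝ) * G := by simp
    _ ≤ _ := mul_le_mul_of_nonneg_right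
      (by exact_mod_cast (Finset.card_le_univ s).trans_eq (Fintype.card_fin _)) (hGL.nonneg i).1

/-- The reward at time `l` does not feel later decisions, so the policy may be frozen at `w₀` after
time `l` before differentiating. Only scores at times `h ≤ l` appear, with no need to show that
later scores have mean zero. Freezing at the point of differentiation makes the weights at `w₀` the
true ones. -/
theorem hasFDerivAt_tsum_discountedReward (hγ : X.γ ∈ Set.Ioo (0 : ℝ) 1) (hR : X.RewardsIn R)
    (hGL : X.BoundedLogPolicy G L) (i : I) (l : Fin X.H) (w₀ : Param d) :
    HasFDerivAt (fun w => ∑' τ, X.trajProb i w τ * X.discountedReward i τ l)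
      (∑' τ, X.trajProb i w₀ τ • X.discountedReward i τ l • InnerProductSpace.toDual ℝ (Param d)
        (∑ h ∈ Finset.Iic l, gradient (X.logPolicy i (τ.1 h.castSucc) (τ.2 h)) w₀)) w₀ := by
  have hw (τ) : X.trajProb i w₀ τ = X.frozenWeight i (Finset.Iic l) w₀ τ *
      Real.exp (∑ h ∈ Finset.Iic l, X.logPolicy i (τ.1 h.castSucc) (τ.2 h) w₀) := by
    rw [← hGL.toReal_pathWeight_mixedPolicy, trajProb_eq_toReal_pathWeight, mixedPolicy_self]
  have hfun : (fun w => ∑' τ, X.trajProb i w τ * X.discountedReward i τ l) = fun w =>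
      ∑' τ, (X.frozenWeight i (Finset.Iic l) w₀ τ *
        Real.exp (∑ h ∈ Finset.Iic l, X.logPolicy i (τ.1 h.castSucc) (τ.2 h) w)) •
          X.discountedReward i τ l := by
    funext w
    simp only [← hGL.toReal_pathWeight_mixedPolicy, trajProb_eq_toReal_pathWeight, smul_eq_mul]
    -- The bound is `l + 1` because the reward at time `l` involves the state and the action at time
    -- `l` itself.
    refine (X.mdp i).tsum_toReal_pathWeight_mul_congr (l + 1) _ _ (fun h hh => ?_) _
      (fun τ => hR.discountedReward_nonneg hγ i τ l) fun τ τ' hττ => ?_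
    · rw [mixedPolicy, if_pos (Finset.mem_Iic.2 (Fin.le_def.2 (Nat.lt_succ_iff.1 hh)))]
    · rw [discountedReward, discountedReward, (hττ l (Nat.lt_succ_self _)).1,
        (hττ l (Nat.lt_succ_self _)).2]
  rw [hfun]
  refine (hasFDerivAt_tsum_exp_smul (frozenWeight_nonneg i (Finset.Iic l) w₀)
    (fun τ w => hGL.hasFDerivAt_sum i (Finset.Iic l) τ w)
    (fun τ w => hGL.norm_sum_gradient_le i _ τ w)
    (v := fun τ _ => X.discountedReward i τ l) (v' := fun _ _ => 0)
    (fun τ w => hasFDerivAt_const _ _)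
    (fun τ w => (Real.norm_of_nonneg (hR.discountedReward_nonneg hγ i τ l)).trans_le
      (hR.discountedReward_le hγ i τ l)) (N := 0) (fun τ w => by simp)
    (fun w => ?_) w₀).congr_fderiv ?_
  · simp only [← hGL.toReal_pathWeight_mixedPolicy]
    exact ((X.mdp i).hasSum_toReal_pathWeight _).summable
  · refine tsum_congr fun τ => ?_
    rw [← hw]
    congr 1
    ext y
    simp [mul_comm]

/-- Exchanging the sums over `h ≤ l` passes from rewards-to-go to one score sum per reward, the form
that causality yields. -/
theorem policyGrad_eq_sum (i : I) (w : Param d) (τ : Traj (S i) (A i) X.H) :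
    X.policyGrad i w τ = ∑ l, X.discountedReward i τ l •
      ∑ h ∈ Finset.Iic l, gradient (X.logPolicy i (τ.1 h.castSucc) (τ.2 h)) w := by
  simp only [policyGrad, rewardFrom, Finset.sum_smul, Finset.smul_sum]
  exact Finset.sum_comm' fun x y => by simp

/-- The policy gradient theorem. -/
theorem hasGradientAt_J (hγ : X.γ ∈ Set.Ioo (0 : ℝ) 1) (hR : X.RewardsIn R)
    (hGL : X.BoundedLogPolicy G L) (i : I) (w : Param d) :
    HasGradientAt (X.J i) (∑' τ, X.trajProb i w τ • X.policyGrad i w τ) w := by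
  have hJ : X.J i = fun w => ∑ l, ∑' τ, X.trajProb i w τ * X.discountedReward i τ l := by
    funext w
    simp only [J, trajReward, Finset.mul_sum]
    refine Summable.tsum_finsetSum fun l _ => ?_
    exact summable_smul_of_bounded (X.trajProb_nonneg i w) (X.hasSum_trajProb i w).summable
      fun τ => (Real.norm_of_nonneg (hR.discountedReward_nonneg hγ i τ l)).trans_le
      (hR.discountedReward_le hγ i τ l)
  rw [hasGradientAt_iff_hasFDerivAt, hJ]
  refine (HasFDerivAt.fun_sum fun l _ =>
    hasFDerivAt_tsum_discountedReward hγ hR hGL i l w).congr_fderiv ?_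
  rw [← Summable.tsum_finsetSum fun l _ => ?_]
  · have h := ((InnerProductSpace.toDual ℝ (Param d)).toContinuousLinearEquiv.hasSum'.2
      (summable_trajProb_smul_policyGrad hγ hR hGL i w).hasSum).tsum_eq
    refine Eq.trans ?_ h
    refine tsum_congr fun τ => ?_
    simp [policyGrad_eq_sum, Finset.smul_sum, map_sum]
  · refine summable_smul_of_bounded (C := X.γ ^ (l : ℕ) * R * (X.H * G))
      (X.trajProb_nonneg i w) (X.hasSum_trajProb i w).summable fun τ => ?_
    rw [norm_smul, Real.norm_of_nonneg (hR.discountedReward_nonneg hγ i τ l)]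
    exact mul_le_mul (hR.discountedReward_le hγ i τ l) (hGL.norm_sum_gradient_le i _ τ w)
      (norm_nonneg _) (mul_nonneg (pow_nonneg hγ.1.le _) (hR.nonneg i))

theorem gradient_J (hγ : X.γ ∈ Set.Ioo (0 : ℝ) 1) (hR : X.RewardsIn R)
    (hGL : X.BoundedLogPolicy G L) (i : I) (w : Param d) :
    gradient (X.J i) w = ∑' τ, X.trajProb i w τ • X.policyGrad i w τ :=
  (hasGradientAt_J hγ hR hGL i w).gradient

theorem norm_gradient_J_le (hγ : X.γ ∈ Set.Ioo (0 : ℝ) 1) (hR : X.RewardsIn R)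
    (hGL : X.BoundedLogPolicy G L) (i : I) (w : Param d) :
    ‖gradient (X.J i) w‖ ≤ X.gHat G R := by
  rw [gradient_J hγ hR hGL]
  exact norm_tsum_smul_le (X.trajProb_nonneg i w) (X.hasSum_trajProb i w)
    (norm_policyGrad_le hγ hR hGL i w)

/-- The derivative of `E g_i` is the mean of score ⊗ `g_i` plus the derivative of `g_i`. These are
bounded by `HG·Ĝ` and `LR/(1-γ)²`, which add up to `L̂`. -/
theorem norm_gradient_J_sub_le (hγ : X.γ ∈ Set.Ioo (0 : ℝ) 1) (hR : X.RewardsIn R)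
    (hGL : X.BoundedLogPolicy G L) (i : I) (w w' : Param d) :
    ‖gradient (X.J i) w - gradient (X.J i) w'‖ ≤ X.lHat G L R * ‖w - w'‖ := by
  have hG := (hGL.nonneg i).1
  have hL := (hGL.nonneg i).2
  have hq (w τ) : X.trajProb i w τ = X.frozenWeight i Finset.univ w τ *
      Real.exp (∑ h, X.logPolicy i (τ.1 h.castSucc) (τ.2 h) w) := by
    rw [← hGL.toReal_pathWeight_mixedPolicy, trajProb_eq_toReal_pathWeight, mixedPolicy_self]
  -- No time is frozen, so the base parameter is irrelevant and one series represents the gradient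
  -- at every `w`.
  have hfr (w τ) : X.frozenWeight i Finset.univ w τ = X.frozenWeight i Finset.univ 0 τ := by
    simp [frozenWeight]
  have hq' (w τ) : X.frozenWeight i Finset.univ 0 τ *
      Real.exp (∑ h, X.logPolicy i (τ.1 h.castSucc) (τ.2 h) w) = X.trajProb i w τ := by
    rw [hq, hfr w]
  have hgrad (τ) (w : Param d) : HasFDerivAt (fun w => X.policyGrad i w τ)
      (∑ h, X.rewardFrom i τ h •
        fderiv ℝ (gradient (X.logPolicy i (τ.1 h.castSucc) (τ.2 h))) w) w :=
    HasFDerivAt.fun_sum fun h _ => (hGL.diff_grad i _ _ w).hasFDerivAt.fun_const_smul _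
  have hN (τ) (w : Param d) : ‖∑ h, X.rewardFrom i τ h •
      fderiv ℝ (gradient (X.logPolicy i (τ.1 h.castSucc) (τ.2 h))) w‖ ≤
      R / (1 - X.γ) ^ 2 * L := by
    calc _ ≤ ∑ h, X.rewardFrom i τ h * L := by
          refine norm_sum_le_of_le _ fun h _ => ?_
          rw [norm_smul, Real.norm_of_nonneg (hR.rewardFrom_nonneg hγ i τ h)]
          exact mul_le_mul_of_nonneg_left (hGL.hess_le ..) (hR.rewardFrom_nonneg hγ i τ h)
      _ = (∑ h, X.rewardFrom i τ h) * L := by rw [Finset.sum_mul]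
      _ ≤ _ := mul_le_mul_of_nonneg_right (hR.sum_rewardFrom_le hγ i τ) hL
  have hder := hasFDerivAt_tsum_exp_smul (frozenWeight_nonneg i Finset.univ 0)
    (fun τ w => hGL.hasFDerivAt_sum i Finset.univ τ w)
    (fun τ w => hGL.norm_sum_gradient_le i _ τ w) hgrad
    (fun τ w => norm_policyGrad_le hγ hR hGL i w τ) hN
    (fun w => by simp only [hq']; exact (X.hasSum_trajProb i w).summable)
  simp only [hq', ← gradient_J hγ hR hGL] at hder
  refine Convex.norm_image_sub_le_of_norm_hasFDerivWithin_le (𝕜 := ℝ) (s := Set.univ)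
    (fun y _ => (hder y).hasFDerivWithinAt) (fun y _ => ?_) convex_univ (Set.mem_univ _)
    (Set.mem_univ _)
  refine norm_tsum_smul_le (X.trajProb_nonneg i y) (X.hasSum_trajProb i y) fun τ => ?_
  calc _ ≤ X.H * G * X.gHat G R + R / (1 - X.γ) ^ 2 * L := by
        refine (norm_add_le _ _).trans (add_le_add ?_ (hN τ y))
        rw [ContinuousLinearMap.norm_smulRight_apply]
        exact mul_le_mul (hGL.norm_sum_gradient_le i _ τ y) (norm_policyGrad_le hγ hR hGL i y τ)
          (norm_nonneg _) (mul_nonneg (Nat.cast_nonneg _) hG)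
    _ = _ := by rw [gHat, lHat]; ring

end MetaRL

/-! ### The Moreau envelope of a smooth bounded function. -/

section MoreauEnvelope

variable {E : Type*} [NormedAddCommGroup E]

/-- The (upper) Moreau envelope of `f`. -/
noncomputable def upperEnvelope (f : E → ℝ) (lam : ℝ) (w : E) : ℝ :=
  ⨆ θ : E, (f θ - lam / 2 * ‖θ - w‖ ^ 2)

theorem upperEnvelope_eq {f : E → ℝ} {lam : ℝ} {w θ : E}
    (hθ : IsMaxOn (fun θ => f θ - lam / 2 * ‖θ - w‖ ^ 2) Set.univ θ) :
    upperEnvelope f lam w = f θ - lam / 2 * ‖θ - w‖ ^ 2 :=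
  le_antisymm (ciSup_le fun x => hθ (Set.mem_univ x))
    (le_ciSup (f := fun θ => f θ - lam / 2 * ‖θ - w‖ ^ 2)
      ⟨_, by rintro _ ⟨x, rfl⟩; exact hθ (Set.mem_univ x)⟩ θ)

variable [InnerProductSpace ℝ E]

/-- A function with a Lipschitz gradient lies above its tangents up to a quadratic term. -/
theorem le_of_gradient_lipschitz [CompleteSpace E] {f : E → ℝ} (hf : Differentiable ℝ f) {C : ℝ}
    (hC : ∀ x y, ‖gradient f x - gradient f y‖ ≤ C * ‖x - y‖) (x y : E) :
    f x + inner ℝ (gradient f x) (y - x) - C / 2 * ‖y - x‖ ^ 2 ≤ f y := by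
  -- The term in `t ^ 2` compensates the Lipschitz variation of the gradient along the segment, so
  -- this function is monotone on `[0, 1]`; its endpoint values give the claim.
  have hder (t : ℝ) : HasDerivAt (fun t : ℝ => f (x + t • (y - x)) -
      t * inner ℝ (gradient f x) (y - x) + C / 2 * ‖y - x‖ ^ 2 * t ^ 2)
      (inner ℝ (gradient f (x + t • (y - x))) (y - x) - inner ℝ (gradient f x) (y - x) +
        C * ‖y - x‖ ^ 2 * t) t := by
    have h1 : HasDerivAt (fun t : ℝ => x + t • (y - x)) (y - x) t := by
      simpa using ((hasDerivAt_id t).smul_const (y - x)).const_add x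
    have h2 := (hf (x + t • (y - x))).hasGradientAt.hasFDerivAt.comp_hasDerivAt t h1
    rw [InnerProductSpace.toDual_apply_apply] at h2
    refine ((h2.sub ((hasDerivAt_id t).mul_const _)).add
      ((hasDerivAt_pow 2 t).const_mul (C / 2 * ‖y - x‖ ^ 2))).congr_deriv ?_
    simp
    ring
  have hmono : MonotoneOn (fun t : ℝ => f (x + t • (y - x)) -
      t * inner ℝ (gradient f x) (y - x) + C / 2 * ‖y - x‖ ^ 2 * t ^ 2) (Set.Icc 0 1) := by
    refine monotoneOn_of_deriv_nonneg (convex_Icc 0 1)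
      (fun t _ => (hder t).continuousAt.continuousWithinAt)
      (fun t _ => (hder t).differentiableAt.differentiableWithinAt) fun t ht => ?_
    rw [interior_Icc] at ht
    rw [(hder t).deriv, ← inner_sub_left]
    have h1 := abs_le.1 (abs_real_inner_le_norm (gradient f (x + t • (y - x)) - gradient f x)
      (y - x))
    have h2 := mul_le_mul_of_nonneg_right (hC (x + t • (y - x)) x) (norm_nonneg (y - x))
    rw [add_sub_cancel_left, norm_smul, Real.norm_of_nonneg ht.1.le] at h2
    nlinarith [h1.1]
  have := hmono (Set.left_mem_Icc.2 zero_le_one) (Set.right_mem_Icc.2 zero_le_one) zero_le_one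
  simp only [zero_smul, add_zero, one_smul, add_sub_cancel, zero_mul, sub_zero, one_mul, one_pow,
    mul_one, ne_eq, OfNat.ofNat_ne_zero, not_false_eq_true, zero_pow, mul_zero] at this
  linarith

/-- A function with a quadratic first-order remainder has a gradient. -/
theorem hasGradientAt_of_abs_sub_le [CompleteSpace E] {f : E → ℝ} {x g : E} {C : ℝ}
    (h : ∀ y, |f y - f x - inner ℝ g (y - x)| ≤ C * ‖y - x‖ ^ 2) : HasGradientAt f g x := by
  rw [hasGradientAt_iff_isLittleO]
  have h1 : (fun y => f y - f x - inner ℝ g (y - x)) =O[nhds x] fun y => ‖y - x‖ ^ 2 :=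
    Asymptotics.IsBigO.of_bound C (Filter.Eventually.of_forall fun y => by
      simpa using h y)
  exact h1.trans_isLittleO ((Asymptotics.isLittleO_norm_pow_id one_lt_two).comp_tendsto
    (tendsto_sub_nhds_zero_iff.2 Filter.tendsto_id))

variable {f : E → ℝ} {lam Lh M : ℝ}

theorem exists_isMaxOn_sub_norm_sq [FiniteDimensional ℝ E] (hf : Continuous f) (hlam : 0 < lam)
    (h0 : ∀ x, 0 ≤ f x) (hM : ∀ x, f x ≤ M) (w : E) :
    ∃ θ, IsMaxOn (fun θ => f θ - lam / 2 * ‖θ - w‖ ^ 2) Set.univ θ := by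
  have hM0 : 0 ≤ M := (h0 w).trans (hM w)
  -- Chosen so that `lam / 2 * r ^ 2 = M`: outside the ball the objective is at most `0`, hence at
  -- most its value `f w` at the centre.
  set r := √(2 * M / lam)
  have hr : r ^ 2 = 2 * M / lam := Real.sq_sqrt (by positivity)
  have hcont : Continuous fun θ => f θ - lam / 2 * ‖θ - w‖ ^ 2 := by fun_prop
  obtain ⟨θ, -, hθ⟩ := (isCompact_closedBall w r).exists_isMaxOn
    (Metric.nonempty_closedBall.2 (Real.sqrt_nonneg _)) hcont.continuousOn
  refine ⟨θ, fun x _ => ?_⟩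
  by_cases hx : x ∈ Metric.closedBall w r
  · exact hθ hx
  · have hw := hθ (Metric.mem_closedBall_self (x := w) (Real.sqrt_nonneg _))
    simp only [Set.mem_ofPred_eq, sub_self, norm_zero] at hw ⊢
    have h1 : r ^ 2 ≤ ‖x - w‖ ^ 2 := by
      rw [mem_closedBall_iff_norm, not_le] at hx
      exact pow_le_pow_left₀ (Real.sqrt_nonneg _) hx.le 2
    have h2 : M ≤ lam / 2 * ‖x - w‖ ^ 2 := by
      calc M = lam / 2 * r ^ 2 := by rw [hr]; field_simp
        _ ≤ _ := mul_le_mul_of_nonneg_left h1 (by positivity)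
    linarith [h0 w, hM x]

theorem gradient_eq_of_isMaxOn [CompleteSpace E] (hf : Differentiable ℝ f) {w θ : E}
    (hθ : IsMaxOn (fun θ => f θ - lam / 2 * ‖θ - w‖ ^ 2) Set.univ θ) :
    gradient f θ = lam • (θ - w) := by
  have h1 : HasFDerivAt (fun θ => f θ - lam / 2 * ‖θ - w‖ ^ 2) _ θ :=
    (hf θ).hasGradientAt.hasFDerivAt.sub
      (((hasFDerivAt_id θ).sub_const w).norm_sq.const_mul (lam / 2))
  have h2 := (hθ.isLocalMax Filter.univ_mem).hasFDerivAt_eq_zero h1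
  refine ext_inner_right ℝ fun v => ?_
  have h3 := DFunLike.congr_fun h2 v
  simp only [id_eq, sub_apply, InnerProductSpace.toDual_apply_apply, smul_apply,
    ContinuousLinearMap.comp_id, innerSL_apply_apply, smul_eq_mul, nsmul_eq_mul, zero_apply,
    Nat.cast_ofNat] at h3
  rw [real_inner_smul_left]
  linarith

variable [CompleteSpace E]

/-- The linear term `lam • (θ - θ')` outweighs the variation of `gradient f`. With `θ` arbitrary,
this serves both for the stability of the maximizer in `w` and for the error of approximate
solutions. -/
theorem norm_sub_le_of_gradient_eq (hlip : ∀ x y, ‖gradient f x - gradient f y‖ ≤ Lh * ‖x - y‖)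
    (hlam : 0 < lam) {w θ' : E} (hθ' : gradient f θ' = lam • (θ' - w)) (θ : E) :
    (lam - Lh) * ‖θ - θ'‖ ≤ ‖gradient f θ - lam • (θ - w)‖ := by
  have h1 : lam • (θ - θ') = (gradient f θ - gradient f θ') - (gradient f θ - lam • (θ - w)) := by
    rw [hθ']; module
  have h2 : lam * ‖θ - θ'‖ ≤ Lh * ‖θ - θ'‖ + ‖gradient f θ - lam • (θ - w)‖ := by
    calc lam * ‖θ - θ'‖ = ‖lam • (θ - θ')‖ := by rw [norm_smul, Real.norm_of_nonneg hlam.le]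
      _ ≤ _ := h1 ▸ (norm_sub_le _ _).trans (add_le_add_left (hlip _ _) _)
  linarith

/-- The assumptions on the function whose envelope is taken. -/
structure SmoothBounded (f : E → ℝ) (lam Lh C M : ℝ) : Prop where
  diff : Differentiable ℝ f
  lip : ∀ x y, ‖gradient f x - gradient f y‖ ≤ Lh * ‖x - y‖
  Lh_nonneg : 0 ≤ Lh
  lt : Lh < lam
  C_nonneg : 0 ≤ C
  le_C : lam * Lh ≤ C * (lam - Lh)
  nonneg : ∀ x, 0 ≤ f x
  le : ∀ x, f x ≤ M

namespace SmoothBounded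

variable {C : ℝ} (h : SmoothBounded f lam Lh C M)

include h

theorem norm_prox_sub_le {w w' θ θ' : E} (hθ : gradient f θ = lam • (θ - w))
    (hθ' : gradient f θ' = lam • (θ' - w')) :
    ‖lam • (θ - w) - lam • (θ' - w')‖ ≤ C * ‖w - w'‖ := by
  have hl : 0 < lam := h.Lh_nonneg.trans_lt h.lt
  have hd : 0 < lam - Lh := sub_pos.2 h.lt
  have h1 := norm_sub_le_of_gradient_eq h.lip hl hθ' θ
  -- The exact solution for `w` is regarded as an approximate solution for `w'`, with this residual.
  have h2 : gradient f θ - lam • (θ - w') = -(lam • (w - w')) := by rw [hθ]; module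
  rw [h2, norm_neg, norm_smul, Real.norm_of_nonneg hl.le] at h1
  rw [← hθ, ← hθ']
  refine (h.lip θ θ').trans (le_of_mul_le_mul_left ?_ hd)
  calc (lam - Lh) * (Lh * ‖θ - θ'‖) = Lh * ((lam - Lh) * ‖θ - θ'‖) := by ring
    _ ≤ Lh * (lam * ‖w - w'‖) := mul_le_mul_of_nonneg_left h1 h.Lh_nonneg
    _ = (lam * Lh) * ‖w - w'‖ := by ring
    _ ≤ (C * (lam - Lh)) * ‖w - w'‖ := mul_le_mul_of_nonneg_right h.le_C (norm_nonneg _)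
    _ = _ := by ring

variable [FiniteDimensional ℝ E]

theorem exists_isMaxOn (w : E) :
    ∃ θ, IsMaxOn (fun θ => f θ - lam / 2 * ‖θ - w‖ ^ 2) Set.univ θ :=
  exists_isMaxOn_sub_norm_sq h.diff.continuous (h.Lh_nonneg.trans_lt h.lt) h.nonneg h.le w

/-- The maximizer at `w` is a competitor at `w'`; expanding the square gives the bound. -/
theorem upperEnvelope_ge {w θ : E}
    (hθ : IsMaxOn (fun θ => f θ - lam / 2 * ‖θ - w‖ ^ 2) Set.univ θ) (w' : E) :
    upperEnvelope f lam w + inner ℝ (lam • (θ - w)) (w' - w) - lam / 2 * ‖w' - w‖ ^ 2 ≤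
      upperEnvelope f lam w' := by
  obtain ⟨θ', hθ'⟩ := h.exists_isMaxOn w'
  rw [upperEnvelope_eq hθ, upperEnvelope_eq hθ']
  have h1 := hθ' (Set.mem_univ θ)
  simp only [Set.mem_ofPred_eq] at h1
  have h2 : ‖θ - w'‖ ^ 2 = ‖θ - w‖ ^ 2 - 2 * inner ℝ (θ - w) (w' - w) + ‖w' - w‖ ^ 2 := by
    rw [← norm_sub_sq_real]; congr 2; abel
  rw [h2] at h1
  rw [real_inner_smul_left]
  linarith

/-- The lower bound is `upperEnvelope_ge`. The upper bound is the same with `w` and `w'` exchanged,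
at the cost `C * ‖w' - w‖ ^ 2` of replacing the slope at `w'` by that at `w`. -/
theorem abs_upperEnvelope_sub_le' {w θ : E}
    (hθ : IsMaxOn (fun θ => f θ - lam / 2 * ‖θ - w‖ ^ 2) Set.univ θ) (w' : E) :
    |upperEnvelope f lam w' - upperEnvelope f lam w - inner ℝ (lam • (θ - w)) (w' - w)| ≤
      (C + lam / 2) * ‖w' - w‖ ^ 2 := by
  obtain ⟨θ', hθ'⟩ := h.exists_isMaxOn w'
  have h1 := h.upperEnvelope_ge hθ w'
  have h2 := h.upperEnvelope_ge hθ' w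
  have h3 := h.norm_prox_sub_le (gradient_eq_of_isMaxOn h.diff hθ')
    (gradient_eq_of_isMaxOn h.diff hθ)
  have h4 := (real_inner_le_norm (lam • (θ' - w') - lam • (θ - w)) (w' - w)).trans
    (mul_le_mul_of_nonneg_right h3 (norm_nonneg _))
  rw [inner_sub_left] at h4
  rw [← neg_sub w' w, inner_neg_right, norm_neg] at h2
  have h5 : 0 ≤ C * ‖w' - w‖ ^ 2 := mul_nonneg h.C_nonneg (sq_nonneg _)
  rw [abs_le]
  constructor <;> linarith

theorem hasGradientAt_upperEnvelope {w θ : E}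
    (hθ : IsMaxOn (fun θ => f θ - lam / 2 * ‖θ - w‖ ^ 2) Set.univ θ) :
    HasGradientAt (upperEnvelope f lam) (lam • (θ - w)) w :=
  hasGradientAt_of_abs_sub_le (h.abs_upperEnvelope_sub_le' hθ)

theorem differentiable_upperEnvelope : Differentiable ℝ (upperEnvelope f lam) := fun w => by
  obtain ⟨θ, hθ⟩ := h.exists_isMaxOn w
  exact (h.hasGradientAt_upperEnvelope hθ).differentiableAt

theorem abs_upperEnvelope_sub_le (w w' : E) :
    |upperEnvelope f lam w' - upperEnvelope f lam w -
      inner ℝ (gradient (upperEnvelope f lam) w) (w' - w)| ≤ (C + lam / 2) * ‖w' - w‖ ^ 2 := by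
  obtain ⟨θ, hθ⟩ := h.exists_isMaxOn w
  rw [(h.hasGradientAt_upperEnvelope hθ).gradient]
  exact h.abs_upperEnvelope_sub_le' hθ w'

theorem norm_gradient_upperEnvelope_sub_le (w w' : E) :
    ‖gradient (upperEnvelope f lam) w - gradient (upperEnvelope f lam) w'‖ ≤ C * ‖w - w'‖ := by
  obtain ⟨θ, hθ⟩ := h.exists_isMaxOn w
  obtain ⟨θ', hθ'⟩ := h.exists_isMaxOn w'
  rw [(h.hasGradientAt_upperEnvelope hθ).gradient, (h.hasGradientAt_upperEnvelope hθ').gradient]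
  exact h.norm_prox_sub_le (gradient_eq_of_isMaxOn h.diff hθ) (gradient_eq_of_isMaxOn h.diff hθ')

theorem norm_gradient_upperEnvelope_le {K : ℝ} (hK : ∀ x, ‖gradient f x‖ ≤ K) (w : E) :
    ‖gradient (upperEnvelope f lam) w‖ ≤ K := by
  obtain ⟨θ, hθ⟩ := h.exists_isMaxOn w
  rw [(h.hasGradientAt_upperEnvelope hθ).gradient, ← gradient_eq_of_isMaxOn h.diff hθ]
  exact hK θ

/-- The error of an approximate solution of the proximal problem. -/
theorem norm_smul_sub_gradient_upperEnvelope_le {ν : ℝ} {w θ : E}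
    (hν : ‖gradient f θ - lam • (θ - w)‖ ≤ ν) :
    ‖lam • (θ - w) - gradient (upperEnvelope f lam) w‖ ≤ lam * ν / (lam - Lh) := by
  have hl : 0 < lam := h.Lh_nonneg.trans_lt h.lt
  obtain ⟨θ', hθ'⟩ := h.exists_isMaxOn w
  have h1 := norm_sub_le_of_gradient_eq h.lip hl (gradient_eq_of_isMaxOn h.diff hθ') θ
  rw [(h.hasGradientAt_upperEnvelope hθ').gradient, ← smul_sub, sub_sub_sub_cancel_right,
    norm_smul, Real.norm_of_nonneg hl.le, mul_div_assoc]
  refine mul_le_mul_of_nonneg_left ?_ hl.le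
  rw [le_div_iff₀ (sub_pos.2 h.lt), mul_comm]
  exact h1.trans hν

theorem upperEnvelope_mem_Icc (w : E) : upperEnvelope f lam w ∈ Set.Icc 0 M := by
  have hl : 0 < lam := h.Lh_nonneg.trans_lt h.lt
  obtain ⟨θ, hθ⟩ := h.exists_isMaxOn w
  rw [upperEnvelope_eq hθ]
  have h1 := hθ (Set.mem_univ w)
  simp only [Set.mem_ofPred_eq, sub_self, norm_zero] at h1
  have h2 : 0 ≤ lam / 2 * ‖θ - w‖ ^ 2 := by positivity
  exact ⟨by linarith [h.nonneg w], by linarith [h.le θ]⟩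

end SmoothBounded

end MoreauEnvelope

/-! ### Differentiation of a mean over tasks. -/

section IntegralOfSmoothFunctions

variable {I E : Type*} [MeasurableSpace I] [NormedAddCommGroup E] [InnerProductSpace ℝ E]
  [FiniteDimensional ℝ E] [CompleteSpace E] [MeasurableSpace E] [BorelSpace E]

/-- Directional derivatives are limits of difference quotients with steps `1 / n`, and the gradient
is assembled from those along an orthonormal basis. -/
theorem measurable_gradient_of_measurable {F : I → E → ℝ} (hF : ∀ w, Measurable fun i => F i w)
    (hd : ∀ i, Differentiable ℝ (F i)) (w : E) : Measurable fun i => gradient (F i) w := by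
  have h1 (b : E) : Measurable fun i => fderiv ℝ (F i) w b := by
    refine measurable_of_tendsto_metrizable
      (f := fun n i => (n : ℝ) • (F i (w + (n : ℝ)⁻¹ • b) - F i w))
      (fun n => ((hF (w + (n : ℝ)⁻¹ • b)).sub (hF w)).const_smul (n : ℝ)) (tendsto_pi_nhds.2 fun i => ?_)
    exact (hd i w).hasFDerivAt.lim b (by simpa using tendsto_natCast_atTop_atTop)
  have h2 : (fun i => gradient (F i) w) = fun i => ∑ k, fderiv ℝ (F i) w
      (stdOrthonormalBasis ℝ E k) • stdOrthonormalBasis ℝ E k := by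
    funext i
    conv_lhs => rw [← (stdOrthonormalBasis ℝ E).sum_repr' (gradient (F i) w)]
    simp only [real_inner_comm (gradient (F i) w), inner_gradient_left]
  rw [h2]
  exact Finset.measurable_fun_sum _ fun k _ => (h1 _).smul_const _

/-- The quadratic remainder is uniform in `i`, so it survives integration and identifies the
gradient directly. -/
theorem hasGradientAt_integral_of_abs_sub_le (p : Measure I) [IsProbabilityMeasure p]
    {F : I → E → ℝ} (hF : ∀ w, Measurable fun i => F i w) (hd : ∀ i, Differentiable ℝ (F i))
    {M K C : ℝ} (hM : ∀ i w, F i w ∈ Set.Icc 0 M) (hK : ∀ i w, ‖gradient (F i) w‖ ≤ K)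
    (hC : ∀ i w w', |F i w' - F i w - inner ℝ (gradient (F i) w) (w' - w)| ≤ C * ‖w' - w‖ ^ 2)
    (w : E) : HasGradientAt (fun w => ∫ i, F i w ∂p) (∫ i, gradient (F i) w ∂p) w := by
  have hi (w : E) : Integrable (fun i => F i w) p :=
    Integrable.of_mem_Icc 0 M (hF w).aemeasurable (Filter.Eventually.of_forall fun i => hM i w)
  have hg : Integrable (fun i => gradient (F i) w) p :=
    Integrable.of_bound (measurable_gradient_of_measurable hF hd w).aestronglyMeasurable K
      (Filter.Eventually.of_forall fun i => hK i w)
  refine hasGradientAt_of_abs_sub_le (C := C) fun w' => ?_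
  have h1 : inner ℝ (∫ i, gradient (F i) w ∂p) (w' - w) =
      ∫ i, inner ℝ (gradient (F i) w) (w' - w) ∂p := by
    rw [real_inner_comm, ← integral_inner hg]
    exact integral_congr_ae (Filter.Eventually.of_forall fun i => real_inner_comm _ _)
  rw [h1, ← integral_sub (hi _) (hi _), ← integral_sub (f := fun i => F i w' - F i w)
    ((hi _).sub (hi _)) (hg.inner_const _)]
  have h2 : ∀ᵐ i ∂p, ‖F i w' - F i w - inner ℝ (gradient (F i) w) (w' - w)‖ ≤
      C * ‖w' - w‖ ^ 2 := Filter.Eventually.of_forall fun i => hC i w w'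
  simpa using norm_integral_le_of_norm_le_const h2

end IntegralOfSmoothFunctions

/-! ### Inner accuracy and measurability of the envelopes. -/

theorem hasSum_prod_pi {ι : Type*} {D : ℕ} {f : Fin D → ι → ℝ} {a : Fin D → ℝ}
    (hf : ∀ k, HasSum (f k) (a k)) :
    HasSum (fun x : Fin D → ι => ∏ k, f k (x k)) (∏ k, a k) := by
  induction D with
  | zero => simp
  | succ D ih =>
    have h1 := ih fun k => hf k.succ
    have h3 : Summable fun i => ‖f 0 i‖ := summable_norm_iff.2 (hf 0).summable
    have h4 : Summable fun y : Fin D → ι => ‖∏ k, f k.succ (y k)‖ := summable_norm_iff.2 h1.summable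
    have h5 := summable_mul_of_summable_norm h3 h4
    have h2 := (hf 0).mul h1 h5
    rw [← (Fin.consEquiv fun _ => ι).hasSum_iff, Fin.prod_univ_succ]
    refine h2.congr_fun ?_
    simp [Fin.prod_univ_succ]

namespace MetaRL

variable {d : ℕ} {I : Type*} {S A : I → Type*} {X : MetaRL d I S A} {R G L : ℝ}

/-- Jensen: the stochastic inner gradient `Y` has mean `m`, and averaging `2⟪m, Y⟫ - ‖m‖² ≤ ‖Y‖²`
gives `‖m‖² ≤ E‖Y‖²`. -/
theorem norm_gradient_J_sub_le_of_innerError (hγ : X.γ ∈ Set.Ioo (0 : ℝ) 1)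
    (hR : X.RewardsIn R) (hGL : X.BoundedLogPolicy G L) {D : ℕ} (hD : 0 < D) {lam ν : ℝ}
    (hν : 0 ≤ ν) {i : I} {w θ : Param d} (h : X.innerError D lam i w θ ≤ ν ^ 2) :
    ‖gradient (X.J i) θ - lam • (θ - w)‖ ≤ ν := by
  set m := gradient (X.J i) θ - lam • (θ - w) with hm
  refine abs_le_of_sq_le_sq' ?_ hν |>.2
  refine le_trans ?_ h
  have hD' : (D : ℝ) ≠ 0 := by positivity
  set Q : (Fin D → Traj (S i) (A i) X.H) → ℝ := fun 𝒟 => ∏ k, X.trajProb i θ (𝒟 k) with hQdef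
  have hQ0 (𝒟) : 0 ≤ Q 𝒟 := Finset.prod_nonneg fun k _ => X.trajProb_nonneg i θ _
  have hQ : HasSum Q 1 := by
    simpa using hasSum_prod_pi (D := D) fun _ => X.hasSum_trajProb i θ
  have hg : HasSum (fun τ => X.trajProb i θ τ * inner ℝ m (X.policyGrad i θ τ))
      (inner ℝ m (gradient (X.J i) θ)) := by
    have := (innerSL ℝ m).hasSum (summable_trajProb_smul_policyGrad hγ hR hGL i θ).hasSum
    rw [← gradient_J hγ hR hGL] at this
    simpa [Function.comp_def, real_inner_smul_right] using this
  have hgj (j : Fin D) : HasSum (fun 𝒟 => Q 𝒟 * inner ℝ m (X.policyGrad i θ (𝒟 j)))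
      (inner ℝ m (gradient (X.J i) θ)) := by
    -- The test function sits in the `j`-th factor and `1` in the others, so the product formula
    -- marginalizes to the `j`-th trajectory.
    have h1 : ∀ k : Fin D, HasSum (fun τ => X.trajProb i θ τ *
        if k = j then inner ℝ m (X.policyGrad i θ τ) else 1)
        (if k = j then inner ℝ m (gradient (X.J i) θ) else 1) := by
      intro k
      split_ifs
      · exact hg
      · simpa using X.hasSum_trajProb i θ
    have h2 := hasSum_prod_pi h1
    simp only [Finset.prod_mul_distrib, Finset.prod_ite_eq', Finset.mem_univ, if_true] at h2
    exact h2
  have hY : HasSum (fun 𝒟 => Q 𝒟 * inner ℝ m (X.innerBatchGrad lam i w θ 𝒟)) (‖m‖ ^ 2) := by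
    have h1 := ((hasSum_sum fun j (_ : j ∈ Finset.univ) => hgj j).mul_left (D : ℝ)⁻¹).sub
      (hQ.mul_right (inner ℝ m (lam • (θ - w))))
    have h2 : (D : ℝ)⁻¹ * ∑ j : Fin D, inner ℝ m (gradient (X.J i) θ) -
        1 * inner ℝ m (lam • (θ - w)) = ‖m‖ ^ 2 := by
      rw [Finset.sum_const, Finset.card_univ, Fintype.card_fin, nsmul_eq_mul,
        inv_mul_cancel_left₀ hD', one_mul, ← inner_sub_right, ← hm, real_inner_self_eq_norm_sq]
    rw [h2] at h1
    refine h1.congr_fun fun 𝒟 => ?_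
    rw [innerBatchGrad, batchGrad, inner_sub_right, real_inner_smul_right, inner_sum,
      ← Finset.mul_sum]
    ring
  have hbd (𝒟 : Fin D → Traj (S i) (A i) X.H) :
      ‖X.innerBatchGrad lam i w θ 𝒟‖ ≤ X.gHat G R + ‖lam • (θ - w)‖ := by
    refine (norm_sub_le _ _).trans (add_le_add_left ?_ _)
    rw [batchGrad, norm_smul, norm_inv, Real.norm_natCast, inv_mul_le_iff₀ (by positivity)]
    refine (norm_sum_le_of_le _ fun k _ => norm_policyGrad_le hγ hR hGL i θ (𝒟 k)).trans_eq ?_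
    simp
  have hs : Summable fun 𝒟 => Q 𝒟 * ‖X.innerBatchGrad lam i w θ 𝒟‖ ^ 2 :=
    summable_smul_of_bounded (C := (X.gHat G R + ‖lam • (θ - w)‖) ^ 2) hQ0 hQ.summable fun 𝒟 => by
      rw [norm_pow, norm_norm]
      exact pow_le_pow_left₀ (norm_nonneg _) (hbd 𝒟) 2
  have hle := hasSum_le (fun 𝒟 => ?_) ((hY.mul_left 2).sub (hQ.mul_right (‖m‖ ^ 2))) hs.hasSum
  · calc ‖m‖ ^ 2 = 2 * ‖m‖ ^ 2 - 1 * ‖m‖ ^ 2 := by ring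
      _ ≤ _ := hle
  · have h1 := norm_sub_sq_real (X.innerBatchGrad lam i w θ 𝒟) m
    have h2 := mul_nonneg (hQ0 𝒟) (h1 ▸ sq_nonneg ‖X.innerBatchGrad lam i w θ 𝒟 - m‖)
    rw [real_inner_comm] at h2
    linarith

theorem lHat_nonneg (hR : X.RewardsIn R) (hGL : X.BoundedLogPolicy G L) (i : I) :
    0 ≤ X.lHat G L R := by
  have h1 := (hGL.nonneg i).2
  have h2 := hR.nonneg i
  unfold lHat
  positivity

theorem smoothBounded_J (hγ : X.γ ∈ Set.Ioo (0 : ℝ) 1) (hR : X.RewardsIn R)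
    (hGL : X.BoundedLogPolicy G L) {lam κ : ℝ} (hlam : X.lHat G L R < lam) (hκ : 1 < κ)
    (hlamκ : κ * X.lHat G L R ≤ lam) (i : I) :
    SmoothBounded (X.J i) lam (X.lHat G L R) (lam / (κ - 1)) (R / (1 - X.γ)) where
  diff w := (hasGradientAt_J hγ hR hGL i w).differentiableAt
  lip := norm_gradient_J_sub_le hγ hR hGL i
  Lh_nonneg := lHat_nonneg hR hGL i
  lt := hlam
  C_nonneg := div_nonneg ((lHat_nonneg hR hGL i).trans hlam.le) (sub_nonneg.2 hκ.le)
  le_C := by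
    have h1 : 0 < κ - 1 := sub_pos.2 hκ
    rw [div_mul_eq_mul_div, le_div_iff₀ h1, mul_assoc]
    exact mul_le_mul_of_nonneg_left (by linarith) ((lHat_nonneg hR hGL i).trans hlam.le)
  nonneg := hR.J_nonneg hγ i
  le := hR.J_le hγ i

theorem taskEnvelope_eq (lam : ℝ) (i : I) :
    X.taskEnvelope lam i = upperEnvelope (X.J i) lam := rfl

/-- By continuity in `θ`, the supremum exceeds `a` exactly when the objective does so at a point of
a countable dense set. -/
theorem measurable_taskEnvelope [MeasurableSpace I] {lam Lh C M : ℝ}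
    (h : ∀ i, SmoothBounded (X.J i) lam Lh C M)
    (hJ : ∀ θ, Measurable fun i => X.J i θ) (w : Param d) :
    Measurable fun i => X.taskEnvelope lam i w := by
  refine measurable_of_Ioi fun a => ?_
  have hset : (fun i => X.taskEnvelope lam i w) ⁻¹' Set.Ioi a =
      ⋃ n, (fun i => X.innerObjective lam i w (TopologicalSpace.denseSeq (Param d) n)) ⁻¹'
        Set.Ioi a := by
    ext i
    obtain ⟨θ, hθ⟩ := (h i).exists_isMaxOn w
    have hcont : Continuous (X.innerObjective lam i w) := by
      have := (h i).diff.continuous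
      unfold innerObjective
      fun_prop
    simp only [Set.mem_preimage, Set.mem_Ioi, Set.mem_iUnion, taskEnvelope_eq, upperEnvelope_eq hθ]
    constructor
    · intro ha
      obtain ⟨_, hx, n, rfl⟩ := (TopologicalSpace.denseRange_denseSeq (Param d)).inter_open_nonempty
        _ (isOpen_Ioi.preimage hcont) ⟨θ, ha⟩
      exact ⟨n, hx⟩
    · rintro ⟨n, hn⟩
      exact hn.trans_le (hθ (Set.mem_univ _))
  rw [hset]
  exact MeasurableSet.iUnion fun n => ((hJ _).sub_const _) measurableSet_Ioi

end MetaRL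

/-! ### Moments of conditionally i.i.d. samples. -/

section ConditionallyIID

variable {Ω Ω₀ 𝓨 E : Type*} [MeasurableSpace Ω] [MeasurableSpace Ω₀] [MeasurableSpace 𝓨]
  [NormedAddCommGroup E] [InnerProductSpace ℝ E]

/-- Given `e`, the variables `Y j` are independent and have the law `η`. -/
structure IsCondIID (P : Measure Ω) (e : Ω → Ω₀) {B : ℕ} (Y : Fin B → Ω → 𝓨)
    (η : Kernel Ω₀ 𝓨) : Prop where
  measurable : Measurable e
  measurable_var : ∀ j, Measurable (Y j)
  sampling : ∀ F : Set Ω₀, MeasurableSet F → ∀ C : Fin B → Set 𝓨, (∀ j, MeasurableSet (C j)) →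
    P (e ⁻¹' F ∩ {ω | ∀ j, Y j ω ∈ C j}) = ∫⁻ ω in e ⁻¹' F, ∏ j, η (e ω) (C j) ∂P

theorem integral_inner_prod_self [CompleteSpace E] (μ : Measure 𝓨) [IsProbabilityMeasure μ] {f : 𝓨 → E}
    (hf : Integrable f μ) :
    ∫ z, inner ℝ (f z.1) (f z.2) ∂(μ.prod μ) = ‖∫ y, f y ∂μ‖ ^ 2 := by
  have hi : Integrable (fun z : 𝓨 × 𝓨 => inner ℝ (f z.1) (f z.2)) (μ.prod μ) := by
    refine Integrable.mono' (hf.norm.mul_prod hf.norm)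
      (hf.1.comp_fst.inner hf.1.comp_snd) (Filter.Eventually.of_forall fun z => ?_)
    exact norm_inner_le_norm _ _
  rw [integral_prod _ hi]
  simp only [integral_inner hf]
  have h1 (x : 𝓨) : inner ℝ (f x) (∫ y, f y ∂μ) = inner ℝ (∫ y, f y ∂μ) (f x) :=
    real_inner_comm _ _
  simp only [h1, integral_inner hf, real_inner_self_eq_norm_sq]

namespace IsCondIID

variable [MeasurableSpace E] [BorelSpace E] [SecondCountableTopology E]

variable {P : Measure Ω} [IsProbabilityMeasure P] {e : Ω → Ω₀} {B : ℕ} {Y : Fin B → Ω → 𝓨}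
  {η : Kernel Ω₀ 𝓨} {f : Ω₀ × 𝓨 → E} {K : ℝ}

theorem integrable_inner (h : IsCondIID P e Y η) (hf : Measurable f) (hK : ∀ z, ‖f z‖ ≤ K)
    (j k : Fin B) : Integrable (fun ω => inner ℝ (f (e ω, Y j ω)) (f (e ω, Y k ω))) P := by
  refine Integrable.of_bound ((hf.comp (h.measurable.prodMk (h.measurable_var j))).inner
    (hf.comp (h.measurable.prodMk (h.measurable_var k)))).aestronglyMeasurable (K * K)
    (Filter.Eventually.of_forall fun ω => ?_)
  exact (norm_inner_le_norm _ _).trans (mul_le_mul (hK _) (hK _) (norm_nonneg _)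
    ((norm_nonneg _).trans (hK (e ω, Y j ω))))

variable [IsMarkovKernel η]

theorem map_pair (h : IsCondIID P e Y η) (j : Fin B) :
    P.map (fun ω => (e ω, Y j ω)) = P.map e ⊗ₘ η := by
  have := Measure.isProbabilityMeasure_map (μ := P) h.measurable.aemeasurable
  refine Measure.ext_prod fun {s t} hs ht => ?_
  rw [Measure.map_apply (h.measurable.prodMk (h.measurable_var j)) (hs.prod ht),
    Measure.compProd_apply_prod hs ht, setLIntegral_map hs (η.measurable_coe ht) h.measurable]
  have h1 := h.sampling s hs (fun k => if k = j then t else Set.univ) fun k => by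
    split_ifs
    exacts [ht, MeasurableSet.univ]
  have h2 (ω : Ω) : ∏ k, η (e ω) (if k = j then t else Set.univ) = η (e ω) t := by
    rw [Finset.prod_eq_single j] <;> simp +contextual
  simp only [h2] at h1
  rw [← h1]
  congr 1
  ext ω
  simp only [Set.mem_preimage, Set.mem_prod, Set.mem_inter_iff, Set.mem_ofPred_eq]
  refine and_congr_right fun _ => ⟨fun hj k => ?_, fun hk => by simpa using hk j⟩
  split_ifs with hkj
  exacts [hkj ▸ hj, Set.mem_univ _]

/-- Checked on boxes, with the whole space as constraint on the remaining samples. Joint laws of two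
samples suffice, since only second moments are needed. -/
theorem map_triple (h : IsCondIID P e Y η) {j k : Fin B} (hjk : j ≠ k) :
    P.map (fun ω => (e ω, Y j ω, Y k ω)) = P.map e ⊗ₘ (η ×ₖ η) := by
  have := Measure.isProbabilityMeasure_map (μ := P) h.measurable.aemeasurable
  refine Measure.ext_prod₃ fun {s t u} hs ht hu => ?_
  rw [Measure.map_apply (h.measurable.prodMk ((h.measurable_var j).prodMk (h.measurable_var k)))
    (hs.prod (ht.prod hu)), Measure.compProd_apply_prod hs (ht.prod hu),
    setLIntegral_map hs (Kernel.measurable_coe _ (ht.prod hu)) h.measurable]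
  have h1 := h.sampling s hs
    (fun l => (if l = j then t else Set.univ) ∩ (if l = k then u else Set.univ)) fun l => by
      split_ifs
      exacts [ht.inter hu, ht.inter .univ, .inter .univ hu, .inter .univ .univ]
  have h2 (ω : Ω) : ∏ l, η (e ω) ((if l = j then t else Set.univ) ∩
      (if l = k then u else Set.univ)) = η (e ω) t * η (e ω) u := by
    rw [Finset.prod_eq_mul j k hjk]
    · simp [hjk, hjk.symm]
    · rintro l - ⟨h3, h4⟩
      simp [h3, h4]
    · simp
    · simp
  simp only [h2] at h1
  simp only [Kernel.prod_apply, Measure.prod_prod]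
  rw [← h1]
  congr 1
  ext ω
  simp only [Set.mem_preimage, Set.mem_prod, Set.mem_inter_iff, Set.mem_ofPred_eq]
  refine and_congr_right fun _ => ⟨fun hj l => ⟨?_, ?_⟩, fun hl => ?_⟩
  · split_ifs with hlj
    exacts [hlj ▸ hj.1, Set.mem_univ _]
  · split_ifs with hlk
    exacts [hlk ▸ hj.2, Set.mem_univ _]
  · exact ⟨by simpa using (hl j).1, by simpa using (hl k).2⟩

variable [CompleteSpace E]

theorem integral_inner_eq (h : IsCondIID P e Y η) (hf : Measurable f) (hK : ∀ z, ‖f z‖ ≤ K)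
    {u : Ω₀ → E} (hu : Measurable u) {K' : ℝ} (hK' : ∀ a, ‖u a‖ ≤ K') (j : Fin B) :
    ∫ ω, inner ℝ (u (e ω)) (f (e ω, Y j ω)) ∂P =
      ∫ ω, inner ℝ (u (e ω)) (∫ y, f (e ω, y) ∂(η (e ω))) ∂P := by
  have := Measure.isProbabilityMeasure_map (μ := P) h.measurable.aemeasurable
  have hm : Measurable fun z : Ω₀ × 𝓨 => inner ℝ (u z.1) (f z) := (hu.comp measurable_fst).inner hf
  have hi : Integrable (fun z : Ω₀ × 𝓨 => inner ℝ (u z.1) (f z)) (P.map e ⊗ₘ η) := by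
    refine Integrable.of_bound hm.aestronglyMeasurable (K' * K)
      (Filter.Eventually.of_forall fun z => ?_)
    exact (norm_inner_le_norm _ _).trans (mul_le_mul (hK' _) (hK _) (norm_nonneg _)
      ((norm_nonneg _).trans (hK' z.1)))
  have h1 := integral_map (μ := P) (φ := fun ω => (e ω, Y j ω))
    (h.measurable.prodMk (h.measurable_var j)).aemeasurable
    (f := fun z => inner ℝ (u z.1) (f z)) hm.aestronglyMeasurable
  rw [← h1, h.map_pair, Measure.integral_compProd hi, integral_map h.measurable.aemeasurable]
  · refine integral_congr_ae (Filter.Eventually.of_forall fun ω => ?_)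
    have hfi : Integrable (fun y => f (e ω, y)) (η (e ω)) :=
      Integrable.of_bound (hf.comp measurable_prodMk_left).aestronglyMeasurable K
        (Filter.Eventually.of_forall fun y => hK _)
    exact integral_inner hfi (u (e ω))
  · exact (hm.stronglyMeasurable.integral_kernel_prod_right' (κ := η)).aestronglyMeasurable

theorem integral_inner_pair_eq (h : IsCondIID P e Y η) (hf : Measurable f)
    (hK : ∀ z, ‖f z‖ ≤ K) {j k : Fin B} (hjk : j ≠ k) :
    ∫ ω, inner ℝ (f (e ω, Y j ω)) (f (e ω, Y k ω)) ∂P =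
      ∫ ω, ‖∫ y, f (e ω, y) ∂(η (e ω))‖ ^ 2 ∂P := by
  have := Measure.isProbabilityMeasure_map (μ := P) h.measurable.aemeasurable
  have hm : Measurable fun z : Ω₀ × 𝓨 × 𝓨 => inner ℝ (f (z.1, z.2.1)) (f (z.1, z.2.2)) :=
    (hf.comp (measurable_fst.prodMk measurable_snd.fst)).inner
      (hf.comp (measurable_fst.prodMk measurable_snd.snd))
  have hi : Integrable (fun z : Ω₀ × 𝓨 × 𝓨 => inner ℝ (f (z.1, z.2.1)) (f (z.1, z.2.2)))
      (P.map e ⊗ₘ (η ×ₖ η)) := by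
    refine Integrable.of_bound hm.aestronglyMeasurable (K * K)
      (Filter.Eventually.of_forall fun z => ?_)
    exact (norm_inner_le_norm _ _).trans (mul_le_mul (hK _) (hK _) (norm_nonneg _)
      ((norm_nonneg _).trans (hK (z.1, z.2.1))))
  have h1 := integral_map (μ := P) (φ := fun ω => (e ω, Y j ω, Y k ω))
    (h.measurable.prodMk ((h.measurable_var j).prodMk (h.measurable_var k))).aemeasurable
    (f := fun z => inner ℝ (f (z.1, z.2.1)) (f (z.1, z.2.2))) hm.aestronglyMeasurable
  rw [← h1, h.map_triple hjk, Measure.integral_compProd hi, integral_map h.measurable.aemeasurable]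
  · refine integral_congr_ae (Filter.Eventually.of_forall fun ω => ?_)
    simp only [Kernel.prod_apply]
    exact integral_inner_prod_self (η (e ω)) (Integrable.of_bound
      (hf.comp measurable_prodMk_left).aestronglyMeasurable K
      (Filter.Eventually.of_forall fun y => hK _))
  · exact (hm.stronglyMeasurable.integral_kernel_prod_right' (κ := η ×ₖ η)).aestronglyMeasurable

/-- The second moment of the mean of `B` conditionally independent vectors. -/
theorem integral_norm_mean_sq_le (h : IsCondIID P e Y η) (hf : Measurable f)
    (hK : ∀ z, ‖f z‖ ≤ K) (hB : 0 < B) :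
    ∫ ω, ‖(B : ℝ)⁻¹ • ∑ j, f (e ω, Y j ω)‖ ^ 2 ∂P ≤
      K ^ 2 / B + ∫ ω, ‖∫ y, f (e ω, y) ∂(η (e ω))‖ ^ 2 ∂P := by
  set q := ∫ ω, ‖∫ y, f (e ω, y) ∂(η (e ω))‖ ^ 2 ∂P
  have hq : 0 ≤ q := integral_nonneg fun _ => sq_nonneg _
  have hB' : (0 : ℝ) < B := by exact_mod_cast hB
  have h1 (ω : Ω) : ‖(B : ℝ)⁻¹ • ∑ j, f (e ω, Y j ω)‖ ^ 2 =
      ((B : ℝ)⁻¹) ^ 2 * ∑ j, ∑ k, inner ℝ (f (e ω, Y j ω)) (f (e ω, Y k ω)) := by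
    rw [norm_smul, mul_pow, Real.norm_of_nonneg (inv_nonneg.2 hB'.le),
      ← real_inner_self_eq_norm_sq (∑ j, f (e ω, Y j ω)), sum_inner]
    simp only [inner_sum]
  simp only [h1]
  rw [integral_const_mul, integral_finsetSum _ fun j _ => integrable_finsetSum _ fun k _ =>
    h.integrable_inner hf hK j k]
  simp only [integral_finsetSum _ fun k _ => h.integrable_inner hf hK _ k]
  -- Off the diagonal the value is exactly `q`; the `B` diagonal terms are at most `K ^ 2`, and
  -- adding `q ≥ 0` there too makes the double sum collapse.
  have h2 (j k : Fin B) : ∫ ω, inner ℝ (f (e ω, Y j ω)) (f (e ω, Y k ω)) ∂P ≤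
      (if j = k then K ^ 2 else 0) + q := by
    split_ifs with hjk
    · subst hjk
      have h3 : ∫ ω, inner ℝ (f (e ω, Y j ω)) (f (e ω, Y j ω)) ∂P ≤ ∫ _, K ^ 2 ∂P := by
        refine integral_mono (h.integrable_inner hf hK j j) (integrable_const _) fun ω => ?_
        simp only [real_inner_self_eq_norm_sq]
        exact pow_le_pow_left₀ (norm_nonneg _) (hK _) 2
      simp at h3
      simp
      linarith
    · rw [h.integral_inner_pair_eq hf hK hjk, zero_add]
  calc ((B : ℝ)⁻¹) ^ 2 * ∑ j : Fin B, ∑ k : Fin B,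
        ∫ ω, inner ℝ (f (e ω, Y j ω)) (f (e ω, Y k ω)) ∂P
      ≤ ((B : ℝ)⁻¹) ^ 2 * ∑ j : Fin B, ∑ k : Fin B, ((if j = k then K ^ 2 else 0) + q) :=
        mul_le_mul_of_nonneg_left
          (Finset.sum_le_sum fun j _ => Finset.sum_le_sum fun k _ => h2 j k) (sq_nonneg _)
    _ = K ^ 2 / B + q := by
        simp only [Finset.sum_add_distrib, Finset.sum_ite_eq, Finset.mem_univ, if_true,
          Finset.sum_const, Finset.card_univ, Fintype.card_fin, nsmul_eq_mul]
        field_simp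

theorem integral_inner_mean_eq (h : IsCondIID P e Y η) (hf : Measurable f) (hK : ∀ z, ‖f z‖ ≤ K)
    {u : Ω₀ → E} (hu : Measurable u) {K' : ℝ} (hK' : ∀ a, ‖u a‖ ≤ K') (hB : 0 < B) :
    ∫ ω, inner ℝ (u (e ω)) ((B : ℝ)⁻¹ • ∑ j, f (e ω, Y j ω)) ∂P =
      ∫ ω, inner ℝ (u (e ω)) (∫ y, f (e ω, y) ∂(η (e ω))) ∂P := by
  have hB' : (B : ℝ) ≠ 0 := by positivity
  simp only [real_inner_smul_right, inner_sum]
  rw [integral_const_mul, integral_finsetSum]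
  · simp only [h.integral_inner_eq hf hK hu hK', Finset.sum_const, Finset.card_univ,
      Fintype.card_fin, nsmul_eq_mul]
    rw [inv_mul_cancel_left₀ hB']
  · intro j _
    refine Integrable.of_bound ((hu.comp h.measurable).inner
      (hf.comp (h.measurable.prodMk (h.measurable_var j)))).aestronglyMeasurable (K' * K)
      (Filter.Eventually.of_forall fun ω => ?_)
    exact (norm_inner_le_norm _ _).trans (mul_le_mul (hK' _) (hK _) (norm_nonneg _)
      ((norm_nonneg _).trans (hK' (e ω))))

end IsCondIID

end ConditionallyIID

/-! ### One step of ascent with biased stochastic gradients. -/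

section AscentStep

variable {Ω Ω₀ I E : Type*} [MeasurableSpace Ω] [MeasurableSpace Ω₀] [MeasurableSpace I]
  [MeasurableSpace E]

theorem isCondIID_compProd {P : Measure Ω} {e : Ω → Ω₀} (he : Measurable e) {p : Measure I}
    [IsProbabilityMeasure p] (κ : Kernel (Ω₀ × I) E) [IsMarkovKernel κ] {B : ℕ}
    {task : Fin B → Ω → I} {θ : Fin B → Ω → E} (htask : ∀ j, Measurable (task j))
    (hθ : ∀ j, Measurable (θ j))
    (h : ∀ F : Set Ω₀, MeasurableSet F → ∀ C : Fin B → Set (I × E), (∀ j, MeasurableSet (C j)) →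
      P (e ⁻¹' F ∩ {ω | ∀ j, (task j ω, θ j ω) ∈ C j}) =
        ∫⁻ ω in e ⁻¹' F, ∏ j, (∫⁻ i, κ (e ω, i) {x | (i, x) ∈ C j} ∂p) ∂P) :
    IsCondIID P e (fun j ω => (task j ω, θ j ω)) (Kernel.const Ω₀ p ⊗ₖ κ) where
  measurable := he
  measurable_var j := (htask j).prodMk (hθ j)
  sampling F hF C hC := by
    rw [h F hF C hC]
    simp only [Kernel.compProd_apply (hC _), Kernel.const_apply]
    rfl

variable [NormedAddCommGroup E] [InnerProductSpace ℝ E] [BorelSpace E] [SecondCountableTopology E]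

/-- The task marginal of `p ⊗ κ` is `p`, so a pointwise error of at most `δ` becomes a conditional
bias of at most `δ`. -/
theorem norm_integral_sub_integral_compProd_le {p : Measure I} [IsProbabilityMeasure p]
    (κ : Kernel (Ω₀ × I) E) [IsMarkovKernel κ] (a : Ω₀) {f : I × E → E} (hf : Measurable f)
    {g : I → E} (hg : Measurable g) {K δ : ℝ} (hfK : ∀ z, ‖f z‖ ≤ K) (hgK : ∀ i, ‖g i‖ ≤ K)
    (hδ : ∀ z, ‖f z - g z.1‖ ≤ δ) :
    ‖∫ z, f z ∂((Kernel.const Ω₀ p ⊗ₖ κ) a) - ∫ i, g i ∂p‖ ≤ δ := by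
  have h1 : ∫ i, g i ∂p = ∫ z, g z.1 ∂((Kernel.const Ω₀ p ⊗ₖ κ) a) := by
    have h2 : ((Kernel.const Ω₀ p ⊗ₖ κ) a).map Prod.fst = p := by
      rw [← Kernel.fst_apply, Kernel.fst_compProd, Kernel.const_apply]
    conv_lhs => rw [← h2]
    exact integral_map measurable_fst.aemeasurable hg.aestronglyMeasurable
  rw [h1, ← integral_sub]
  · simpa using norm_integral_le_of_norm_le_const (μ := (Kernel.const Ω₀ p ⊗ₖ κ) a)
      (Filter.Eventually.of_forall hδ)
  · exact Integrable.of_bound hf.aestronglyMeasurable K (Filter.Eventually.of_forall hfK)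
  · exact Integrable.of_bound (hg.comp measurable_fst).aestronglyMeasurable K
      (Filter.Eventually.of_forall fun z => hgK z.1)

variable [CompleteSpace E]

/-- One step of stochastic gradient ascent for a mean `V` of functions with gradients `g i`, where
the stochastic gradients `lam • (θ j - w)` have an error of at most `δ`. -/
theorem integral_norm_gradient_sq_le_of_step {P : Measure Ω} [IsProbabilityMeasure P] {e : Ω → Ω₀}
    (he : Measurable e) {p : Measure I} [IsProbabilityMeasure p] {κ : Kernel (Ω₀ × I) E}
    [IsMarkovKernel κ] {B : ℕ} (hB : 0 < B) {task : Fin B → Ω → I} {θ : Fin B → Ω → E}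
    (hY : IsCondIID P e (fun j ω => (task j ω, θ j ω)) (Kernel.const Ω₀ p ⊗ₖ κ))
    {V : E → ℝ} {g : I → E → E} {M K C : ℝ} (hV : Differentiable ℝ V)
    (hVM : ∀ w, V w ∈ Set.Icc 0 M) (hVg : ∀ w, gradient V w = ∫ i, g i w ∂p)
    (hVlip : ∀ x y, ‖gradient V x - gradient V y‖ ≤ C * ‖x - y‖)
    (hgm : ∀ w, Measurable fun i => g i w) (hgc : ∀ i, Continuous (g i))
    (hgK : ∀ i w, ‖g i w‖ ≤ K) (hC : 0 ≤ C) {lam δ α : ℝ} (hδ : 0 ≤ δ) (hα : 0 ≤ α)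
    (hαC : α * C ≤ 1) {w₀ : Ω₀ → E} (hw₀ : Measurable w₀) {w' : Ω → E} (hw' : Measurable w')
    (hacc : ∀ j, ∀ᵐ ω ∂P, ‖lam • (θ j ω - w₀ (e ω)) - g (task j ω) (w₀ (e ω))‖ ≤ δ)
    (hstep : ∀ ω, w' ω = w₀ (e ω) + α • ((B : ℝ)⁻¹ • ∑ j, lam • (θ j ω - w₀ (e ω)))) :
    α / 2 * ∫ ω, ‖gradient V (w₀ (e ω))‖ ^ 2 ∂P ≤
      ∫ ω, V (w' ω) ∂P - ∫ ω, V (w₀ (e ω)) ∂P + α / 2 * δ ^ 2 +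
        C / 2 * α ^ 2 * ((K + δ) ^ 2 / B) := by
  have hgm2 : Measurable fun z : I × E => g z.1 z.2 :=
    (measurable_uncurry_of_continuous_of_measurable (u := fun w i => g i w) hgc hgm).comp
      measurable_swap
  have hgz : Measurable fun z : Ω₀ × (I × E) => g z.2.1 (w₀ z.1) :=
    hgm2.comp (measurable_snd.fst.prodMk (hw₀.comp measurable_fst))
  have hxz : Measurable fun z : Ω₀ × (I × E) => lam • (z.2.2 - w₀ z.1) :=
    (measurable_snd.snd.sub (hw₀.comp measurable_fst)).const_smul lam
  have hset : MeasurableSet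
      {z : Ω₀ × (I × E) | ‖lam • (z.2.2 - w₀ z.1) - g z.2.1 (w₀ z.1)‖ ≤ δ} :=
    measurableSet_le (hxz.sub hgz).norm measurable_const
  classical
  -- Accuracy holds only almost surely. Replacing an inaccurate direction by the exact gradient
  -- makes the bounds hold everywhere and changes the step only on a null set.
  set f : Ω₀ × (I × E) → E := fun z =>
    if ‖lam • (z.2.2 - w₀ z.1) - g z.2.1 (w₀ z.1)‖ ≤ δ then lam • (z.2.2 - w₀ z.1)
      else g z.2.1 (w₀ z.1) with hfdef
  have hf : Measurable f := Measurable.ite hset hxz hgz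
  have hfδ (z) : ‖f z - g z.2.1 (w₀ z.1)‖ ≤ δ := by
    simp only [hfdef]
    split_ifs with h
    · exact h
    · simpa using hδ
  have hfK (z) : ‖f z‖ ≤ K + δ := by
    calc ‖f z‖ = ‖g z.2.1 (w₀ z.1) + (f z - g z.2.1 (w₀ z.1))‖ := by rw [add_sub_cancel]
      _ ≤ _ := (norm_add_le _ _).trans (add_le_add (hgK _ _) (hfδ z))
  have hVK (w : E) : ‖gradient V w‖ ≤ K := by
    rw [hVg]
    simpa using norm_integral_le_of_norm_le_const (μ := p)
      (Filter.Eventually.of_forall fun i => hgK i w)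
  have hVgc : Continuous (gradient V) :=
    (LipschitzWith.of_dist_le_mul (K := ⟨C, hC⟩) fun x y => by
      rw [dist_eq_norm, dist_eq_norm]; exact hVlip x y).continuous
  set u : Ω₀ → E := fun a => gradient V (w₀ a) with hu
  have hum : Measurable u := hVgc.measurable.comp hw₀
  set m : Ω₀ → E := fun a => ∫ y, f (a, y) ∂((Kernel.const Ω₀ p ⊗ₖ κ) a) with hm
  have hmm : Measurable m := (hf.stronglyMeasurable.integral_kernel_prod_right').measurable
  have hmu (a : Ω₀) : ‖m a - u a‖ ≤ δ := by
    simp only [hm, hu, hVg]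
    exact norm_integral_sub_integral_compProd_le κ a (hf.comp measurable_prodMk_left) (hgm _)
      (K := K + δ) (fun z => hfK _) (fun i => (hgK i _).trans (by linarith)) (fun z => hfδ _)
  have hmK (a : Ω₀) : ‖m a‖ ≤ K + δ := by
    simpa using norm_integral_le_of_norm_le_const (μ := (Kernel.const Ω₀ p ⊗ₖ κ) a)
      (Filter.Eventually.of_forall fun y => hfK (a, y))
  set dir : Ω → E := fun ω => (B : ℝ)⁻¹ • ∑ j, f (e ω, (task j ω, θ j ω)) with hdir
  have hdm : Measurable dir := by
    refine (Finset.measurable_fun_sum _ fun j _ => ?_).const_smul (B : ℝ)⁻¹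
    exact hf.comp (he.prodMk (hY.measurable_var j))
  have hB' : (0 : ℝ) < B := by exact_mod_cast hB
  have hdK (ω : Ω) : ‖dir ω‖ ≤ K + δ := by
    rw [hdir, norm_smul, norm_inv, Real.norm_natCast, inv_mul_le_iff₀ hB']
    exact (norm_sum_le_of_le _ fun j _ => hfK _).trans_eq (by simp [mul_add])
  have hstep' : ∀ᵐ ω ∂P, w' ω = w₀ (e ω) + α • dir ω := by
    filter_upwards [ae_all_iff.2 hacc] with ω hω
    rw [hstep ω, hdir]
    congr 3
    refine Finset.sum_congr rfl fun j _ => ?_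
    simp only [hfdef, if_pos (hω j)]
  have hVi {x : Ω → E} (hx : Measurable x) : Integrable (fun ω => V (x ω)) P :=
    Integrable.of_mem_Icc 0 M (hV.continuous.measurable.comp hx).aemeasurable
      (Filter.Eventually.of_forall fun ω => hVM _)
  have hsq {x : Ω → E} (hx : Measurable x) {c : ℝ} (hc : ∀ ω, ‖x ω‖ ≤ c) :
      Integrable (fun ω => ‖x ω‖ ^ 2) P :=
    Integrable.of_bound (hx.norm.pow_const 2).aestronglyMeasurable (c ^ 2)
      (Filter.Eventually.of_forall fun ω => by
        rw [norm_pow, norm_norm]; exact pow_le_pow_left₀ (norm_nonneg _) (hc ω) 2)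
  have hin {x y : Ω → E} (hx : Measurable x) (hy : Measurable y) {c c' : ℝ}
      (hc : ∀ ω, ‖x ω‖ ≤ c) (hc' : ∀ ω, ‖y ω‖ ≤ c') :
      Integrable (fun ω => inner ℝ (x ω) (y ω)) P :=
    Integrable.of_bound (hx.inner hy).aestronglyMeasurable (c * c')
      (Filter.Eventually.of_forall fun ω => (norm_inner_le_norm _ _).trans
        (mul_le_mul (hc ω) (hc' ω) (norm_nonneg _) ((norm_nonneg _).trans (hc ω))))
  have hue := hum.comp he
  have hme := hmm.comp he
  have i1 : Integrable (fun ω => inner ℝ (u (e ω)) (dir ω)) P :=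
    hin hue hdm (fun ω => hVK _) hdK
  have i2 : Integrable (fun ω => ‖dir ω‖ ^ 2) P := hsq hdm hdK
  have i3 : Integrable (fun ω => ‖u (e ω)‖ ^ 2) P := hsq hue fun ω => hVK _
  have i4 : Integrable (fun ω => ‖m (e ω)‖ ^ 2) P := hsq hme fun ω => hmK _
  have i5 : Integrable (fun ω => inner ℝ (u (e ω)) (m (e ω))) P :=
    hin hue hme (fun ω => hVK _) fun ω => hmK _
  have i6 : Integrable (fun ω => V (w₀ (e ω)) + α * inner ℝ (u (e ω)) (dir ω)) P :=
    (hVi (hw₀.comp he)).add (i1.const_mul α)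
  have i7 : Integrable (fun ω => 1 / 2 * ‖u (e ω)‖ ^ 2 + 1 / 2 * ‖m (e ω)‖ ^ 2) P :=
    (i3.const_mul _).add (i4.const_mul _)
  have key1 : ∫ ω, (V (w₀ (e ω)) + α * inner ℝ (u (e ω)) (dir ω) -
      C / 2 * α ^ 2 * ‖dir ω‖ ^ 2) ∂P ≤ ∫ ω, V (w' ω) ∂P := by
    refine integral_mono_ae (i6.sub (i2.const_mul (C / 2 * α ^ 2))) (hVi hw') ?_
    filter_upwards [hstep'] with ω hω
    have h1 := le_of_gradient_lipschitz hV hVlip (w₀ (e ω)) (w' ω)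
    rw [hω, add_sub_cancel_left, real_inner_smul_right, norm_smul, mul_pow, Real.norm_eq_abs,
      sq_abs] at h1
    rw [hω]
    linarith
  rw [integral_sub i6 (i2.const_mul _), integral_add (hVi (x := fun ω => w₀ (e ω)) (hw₀.comp he))
    (i1.const_mul α), integral_const_mul, integral_const_mul] at key1
  have key2 : ∫ ω, inner ℝ (u (e ω)) (dir ω) ∂P = ∫ ω, inner ℝ (u (e ω)) (m (e ω)) ∂P :=
    hY.integral_inner_mean_eq hf hfK hum (fun a => hVK _) hB
  have key3 : ∫ ω, ‖dir ω‖ ^ 2 ∂P ≤ (K + δ) ^ 2 / B + ∫ ω, ‖m (e ω)‖ ^ 2 ∂P :=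
    hY.integral_norm_mean_sq_le hf hfK hB
  -- Polarization of `‖m - u‖ ≤ δ`. The term in `‖m‖²` is kept in order to absorb the one in `key3`.
  have key4 : 1 / 2 * ∫ ω, ‖u (e ω)‖ ^ 2 ∂P + 1 / 2 * ∫ ω, ‖m (e ω)‖ ^ 2 ∂P - 1 / 2 * δ ^ 2 ≤
      ∫ ω, inner ℝ (u (e ω)) (m (e ω)) ∂P := by
    have h1 : ∫ ω, (1 / 2 * ‖u (e ω)‖ ^ 2 + 1 / 2 * ‖m (e ω)‖ ^ 2 - 1 / 2 * δ ^ 2) ∂P ≤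
        ∫ ω, inner ℝ (u (e ω)) (m (e ω)) ∂P := by
      refine integral_mono (i7.sub (integrable_const _)) i5
        fun ω => ?_
      have h2 := norm_sub_sq_real (m (e ω)) (u (e ω))
      have h3 := pow_le_pow_left₀ (norm_nonneg _) (hmu (e ω)) 2
      rw [real_inner_comm] at h2
      simp only
      linarith
    rwa [integral_sub i7 (integrable_const _),
      integral_add (i3.const_mul _) (i4.const_mul _), integral_const_mul, integral_const_mul,
      integral_const, probReal_univ, one_smul] at h1
  have hm0 : 0 ≤ ∫ ω, ‖m (e ω)‖ ^ 2 ∂P := integral_nonneg fun _ => sq_nonneg _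
  rw [key2] at key1
  have e1 := mul_le_mul_of_nonneg_left key4 hα
  have e2 := mul_le_mul_of_nonneg_left key3 (by positivity : 0 ≤ C / 2 * α ^ 2)
  -- The step size condition: the curvature loss from `‖m‖²` is at most the gain `α / 2 * ‖m‖²`.
  have e3 : α * C * (α * ∫ ω, ‖m (e ω)‖ ^ 2 ∂P) ≤ 1 * (α * ∫ ω, ‖m (e ω)‖ ^ 2 ∂P) :=
    mul_le_mul_of_nonneg_right hαC (mul_nonneg hα hm0)
  change α / 2 * ∫ ω, ‖u (e ω)‖ ^ 2 ∂P ≤ _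
  nlinarith

end AscentStep

/-! ### Telescoping and the form of the update. -/

theorem average_le_of_ascent_steps {a v : ℕ → ℝ} {T B : ℕ} {α M C K δ : ℝ} (hT : 0 < T)
    (hB : 0 < B) (hα : α = 1 / (2 * √(T : ℝ))) (hC : 0 ≤ C) (hM : 0 ≤ M)
    (hv : ∀ t, v t ∈ Set.Icc 0 M)
    (h : ∀ t, α / 2 * a t ≤ v (t + 1) - v t + α / 2 * δ ^ 2 + C / 2 * α ^ 2 * ((K + δ) ^ 2 / B)) :
    1 / (T : ℝ) * ∑ t ∈ Finset.range T, a t ≤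
      8 * M / √T + δ ^ 2 + 8 * C * K ^ 2 / (B * √T) + 8 * C * δ ^ 2 / (B * √T) := by
  have hT' : (0 : ℝ) < T := by exact_mod_cast hT
  have hB' : (0 : ℝ) < B := by exact_mod_cast hB
  set s := √(T : ℝ)
  have hs : 0 < s := Real.sqrt_pos.2 hT'
  have hs2 : (T : ℝ) = s ^ 2 := (Real.sq_sqrt hT'.le).symm
  have hsum : α / 2 * ∑ t ∈ Finset.range T, a t ≤
      M + T * (α / 2 * δ ^ 2 + C / 2 * α ^ 2 * ((K + δ) ^ 2 / B)) := by
    rw [Finset.mul_sum]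
    calc ∑ t ∈ Finset.range T, α / 2 * a t
        ≤ ∑ t ∈ Finset.range T, (v (t + 1) - v t +
            (α / 2 * δ ^ 2 + C / 2 * α ^ 2 * ((K + δ) ^ 2 / B))) :=
          Finset.sum_le_sum fun t _ => by linarith [h t]
      _ = v T - v 0 + T * (α / 2 * δ ^ 2 + C / 2 * α ^ 2 * ((K + δ) ^ 2 / B)) := by
          rw [Finset.sum_add_distrib, Finset.sum_range_sub, Finset.sum_const, Finset.card_range,
            nsmul_eq_mul]
      _ ≤ _ := by linarith [(hv T).2, (hv 0).1]
  have h1 : 1 / (T : ℝ) * ∑ t ∈ Finset.range T, a t =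
      4 / s * (α / 2 * ∑ t ∈ Finset.range T, a t) := by
    rw [hα, hs2]; field_simp; norm_num
  -- The sharper bound that the argument gives; the factors `8` in the conclusion leave room.
  have h2 : 4 / s * (M + T * (α / 2 * δ ^ 2 + C / 2 * α ^ 2 * ((K + δ) ^ 2 / B))) =
      4 * M / s + δ ^ 2 + C * (K + δ) ^ 2 / (2 * (B * s)) := by
    rw [hα, hs2]; field_simp; ring
  have h3 : C * (K + δ) ^ 2 / (2 * (B * s)) ≤ 8 * C * K ^ 2 / (B * s) + 8 * C * δ ^ 2 / (B * s) := by
    rw [← add_div, div_le_div_iff₀ (by positivity) (by positivity)]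
    have : C * (K + δ) ^ 2 ≤ 2 * (8 * C * K ^ 2 + 8 * C * δ ^ 2) := by
      nlinarith [mul_nonneg hC (sq_nonneg (K - δ)), mul_nonneg hC (sq_nonneg K),
        mul_nonneg hC (sq_nonneg δ)]
    nlinarith [mul_le_mul_of_nonneg_right this (by positivity : 0 ≤ B * s)]
  have h4 : 4 * M / s ≤ 8 * M / s := by gcongr; norm_num
  rw [h1]
  calc _ ≤ 4 / s * (M + T * (α / 2 * δ ^ 2 + C / 2 * α ^ 2 * ((K + δ) ^ 2 / B))) :=
        mul_le_mul_of_nonneg_left hsum (by positivity)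
    _ ≤ _ := by rw [h2]; linarith

theorem smul_add_smul_sum_eq {E : Type*} [AddCommGroup E] [Module ℝ E] {B : ℕ} (hB : 0 < B)
    (α lam : ℝ) (w : E) (θ : Fin B → E) :
    (1 - α * lam) • w + (α * lam / B) • ∑ j, θ j =
      w + α • ((B : ℝ)⁻¹ • ∑ j, lam • (θ j - w)) := by
  have hB' : (B : ℝ) ≠ 0 := by positivity
  rw [← Finset.smul_sum, Finset.sum_sub_distrib, Finset.sum_const, Finset.card_univ,
    Fintype.card_fin, ← Nat.cast_smul_eq_nsmul ℝ]
  match_scalars <;> field_simp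
  ring

/-! ### The meta-objective and the final bound. -/

namespace MetaRL

variable {d : ℕ} {I : Type*} {S A : I → Type*} {X : MetaRL d I S A} {R G L : ℝ}

theorem hasGradientAt_metaObjective [MeasurableSpace I] (p : Measure I) [IsProbabilityMeasure p]
    {lam Lh C M K : ℝ} (hS : ∀ i, SmoothBounded (X.J i) lam Lh C M)
    (hJ : ∀ θ, Measurable fun i => X.J i θ) (hK : ∀ i w, ‖gradient (X.J i) w‖ ≤ K) (w : Param d) :
    HasGradientAt (X.metaObjective p lam) (∫ i, gradient (X.taskEnvelope lam i) w ∂p) w :=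
  hasGradientAt_integral_of_abs_sub_le p (measurable_taskEnvelope hS hJ)
    (fun i => (hS i).differentiable_upperEnvelope) (fun i => (hS i).upperEnvelope_mem_Icc)
    (fun i => (hS i).norm_gradient_upperEnvelope_le (hK i))
    (fun i => (hS i).abs_upperEnvelope_sub_le) w

theorem measurable_gradient_taskEnvelope [MeasurableSpace I] {lam Lh C M : ℝ}
    (hS : ∀ i, SmoothBounded (X.J i) lam Lh C M) (hJ : ∀ θ, Measurable fun i => X.J i θ)
    (w : Param d) : Measurable fun i => gradient (X.taskEnvelope lam i) w :=
  measurable_gradient_of_measurable (measurable_taskEnvelope hS hJ)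
    (fun i => (hS i).differentiable_upperEnvelope) w

theorem metaObjective_mem_Icc [MeasurableSpace I] (p : Measure I) [IsProbabilityMeasure p]
    {lam Lh C M : ℝ} (hS : ∀ i, SmoothBounded (X.J i) lam Lh C M)
    (hJ : ∀ θ, Measurable fun i => X.J i θ) (w : Param d) :
    X.metaObjective p lam w ∈ Set.Icc 0 M := by
  have h1 (i : I) : X.taskEnvelope lam i w ∈ Set.Icc 0 M := (hS i).upperEnvelope_mem_Icc w
  refine ⟨integral_nonneg fun i => (h1 i).1, ?_⟩
  have h2 := integral_mono (μ := p) (Integrable.of_mem_Icc 0 M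
    (measurable_taskEnvelope hS hJ w).aemeasurable (Filter.Eventually.of_forall h1))
    (integrable_const M) fun i => (h1 i).2
  simpa [metaObjective] using h2

theorem norm_gradient_metaObjective_sub_le [MeasurableSpace I] (p : Measure I)
    [IsProbabilityMeasure p] {lam Lh C M K : ℝ} (hS : ∀ i, SmoothBounded (X.J i) lam Lh C M)
    (hJ : ∀ θ, Measurable fun i => X.J i θ) (hK : ∀ i w, ‖gradient (X.J i) w‖ ≤ K)
    (w w' : Param d) :
    ‖gradient (X.metaObjective p lam) w - gradient (X.metaObjective p lam) w'‖ ≤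
      C * ‖w - w'‖ := by
  have hi (w : Param d) : Integrable (fun i => gradient (X.taskEnvelope lam i) w) p :=
    Integrable.of_bound (measurable_gradient_taskEnvelope hS hJ w).aestronglyMeasurable K
      (Filter.Eventually.of_forall fun i => (hS i).norm_gradient_upperEnvelope_le (hK i) w)
  rw [(hasGradientAt_metaObjective p hS hJ hK w).gradient,
    (hasGradientAt_metaObjective p hS hJ hK w').gradient, ← integral_sub (hi w) (hi w')]
  simpa [taskEnvelope_eq] using norm_integral_le_of_norm_le_const (μ := p)
    (Filter.Eventually.of_forall fun i => (hS i).norm_gradient_upperEnvelope_sub_le w w')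

theorem norm_gradient_metaObjective_le [MeasurableSpace I] (p : Measure I)
    [IsProbabilityMeasure p] {lam Lh C M K : ℝ} (hS : ∀ i, SmoothBounded (X.J i) lam Lh C M)
    (hJ : ∀ θ, Measurable fun i => X.J i θ) (hK : ∀ i w, ‖gradient (X.J i) w‖ ≤ K)
    (w : Param d) : ‖gradient (X.metaObjective p lam) w‖ ≤ K := by
  rw [(hasGradientAt_metaObjective p hS hJ hK w).gradient]
  simpa [taskEnvelope_eq] using norm_integral_le_of_norm_le_const (μ := p)
    (Filter.Eventually.of_forall fun i => (hS i).norm_gradient_upperEnvelope_le (hK i) w)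

theorem IsRun.ascent_step [MeasurableSpace I] {p : Measure I} [IsProbabilityMeasure p]
    (hγ : X.γ ∈ Set.Ioo (0 : ℝ) 1) (hJ : ∀ θ, Measurable fun i => X.J i θ)
    (hR : X.RewardsIn R) (hGL : X.BoundedLogPolicy G L) {lam Lh C M : ℝ}
    (hS : ∀ i, SmoothBounded (X.J i) lam Lh C M) (hC : 0 ≤ C) (hlam : 0 ≤ lam) (hLh : Lh < lam)
    {ν α : ℝ} (hν : 0 ≤ ν) {B D : ℕ} (hB : 0 < B) (hD : 0 < D) (hα : 0 ≤ α) (hαC : α * C ≤ 1)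
    {Ω : Type*} [mΩ : MeasurableSpace Ω] {P : Measure Ω} [IsProbabilityMeasure P]
    {ℱ : Filtration ℕ mΩ} {w : ℕ → Ω → Param d}
    {task : ℕ → Fin B → Ω → I} {θ : ℕ → Fin B → Ω → Param d}
    (hrun : X.IsRun p lam ν α B D P ℱ w task θ) (t : ℕ) :
    α / 2 * ∫ ω, ‖gradient (X.metaObjective p lam) (w t ω)‖ ^ 2 ∂P ≤
      ∫ ω, X.metaObjective p lam (w (t + 1) ω) ∂P - ∫ ω, X.metaObjective p lam (w t ω) ∂P +
        α / 2 * (lam * ν / (lam - Lh)) ^ 2 +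
        C / 2 * α ^ 2 * ((X.gHat G R + lam * ν / (lam - Lh)) ^ 2 / B) := by
  have hK := fun i => norm_gradient_J_le hγ hR hGL i
  obtain ⟨κ, hκ, hsamp⟩ := hrun.sampling t
  -- The history is the identity map into `Ω` carrying the smaller σ-algebra `ℱ t`; conditioning on
  -- it is conditioning on `ℱ t`.
  have he : @Measurable Ω Ω mΩ (ℱ t) id := measurable_id'' (ℱ.le t)
  have hY := @isCondIID_compProd Ω Ω I (Param d) mΩ (ℱ t) _ _ P id he p _ κ hκ B (task t) (θ t)
    (hrun.measurable_task t) (hrun.measurable_θ t) hsamp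
  refine @integral_norm_gradient_sq_le_of_step Ω Ω I (Param d) mΩ (ℱ t) _ _ _ _ _ _ _ P _ id he p _
    κ hκ B hB (task t) (θ t) hY (X.metaObjective p lam)
    (fun i => gradient (X.taskEnvelope lam i)) M (X.gHat G R) C
    (fun v => (hasGradientAt_metaObjective p hS hJ hK v).differentiableAt)
    (metaObjective_mem_Icc p hS hJ) (fun v => (hasGradientAt_metaObjective p hS hJ hK v).gradient)
    (norm_gradient_metaObjective_sub_le p hS hJ hK) (measurable_gradient_taskEnvelope hS hJ)
    (fun i => ?_) (fun i => (hS i).norm_gradient_upperEnvelope_le (hK i)) hC lam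
    (lam * ν / (lam - Lh)) α (div_nonneg (mul_nonneg hlam hν) (sub_nonneg.2 hLh.le)) hα hαC
    (w t) (hrun.adapted t) (w (t + 1)) ((hrun.adapted (t + 1)).mono (ℱ.le _) le_rfl)
    (fun j => ?_) (fun ω => ?_)
  · exact (LipschitzWith.of_dist_le_mul (K := ⟨C, hC⟩) fun x y => by
      rw [dist_eq_norm, dist_eq_norm]
      exact (hS i).norm_gradient_upperEnvelope_sub_le x y).continuous
  · filter_upwards [hrun.accurate t j] with ω hω
    exact (hS _).norm_smul_sub_gradient_upperEnvelope_le
      (norm_gradient_J_sub_le_of_innerError hγ hR hGL hD hν hω)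
  · rw [hrun.update t ω, smul_add_smul_sum_eq hB]
    rfl

end MetaRL

theorem theorem1 {d : ℕ} {I : Type*} [MeasurableSpace I] {S A : I → Type*}
    (X : MetaRL d I S A) (p : Measure I) [IsProbabilityMeasure p]
    (hγ : X.γ ∈ Set.Ioo (0 : ℝ) 1)
    (hJ : ∀ θ, Measurable fun i => X.J i θ)
    {R G L : ℝ} (hR : X.RewardsIn R) (hGL : X.BoundedLogPolicy G L)
    {lam κ Lt : ℝ} (hlam : X.lHat G L R < lam)
    (hκ : 1 < κ) (hlamκ : κ * X.lHat G L R ≤ lam) (hLt : Lt = lam / (κ - 1))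
    {ν : ℝ} (hν : 0 ≤ ν) {B D T : ℕ} (hB : 0 < B) (hD : 0 < D)
    (hT : 4 * Lt ^ 2 ≤ (T : ℝ)) {α : ℝ} (hα : α = 1 / (2 * √(T : ℝ)))
    {Ω : Type*} [mΩ : MeasurableSpace Ω] (P : Measure Ω) [IsProbabilityMeasure P]
    (ℱ : Filtration ℕ mΩ) (w : ℕ → Ω → Param d)
    (task : ℕ → Fin B → Ω → I) (θ : ℕ → Fin B → Ω → Param d)
    (hrun : X.IsRun p lam ν α B D P ℱ w task θ) :
    (∀ i v, ∃ θ', IsMaxOn (X.innerObjective lam i v) Set.univ θ') ∧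
    Differentiable ℝ (X.metaObjective p lam) ∧
    (∀ t, Integrable (fun ω => ‖gradient (X.metaObjective p lam) (w t ω)‖ ^ 2) P) ∧
    1 / (T : ℝ) * ∑ t ∈ Finset.range T,
        ∫ ω, ‖gradient (X.metaObjective p lam) (w t ω)‖ ^ 2 ∂P ≤
      8 * R / ((1 - X.γ) * √T)
        + lam ^ 2 * ν ^ 2 / (lam - X.lHat G L R) ^ 2
        + 8 * Lt * X.gHat G R ^ 2 / (B * √T)
        + 8 * Lt * lam ^ 2 * ν ^ 2 / ((lam - X.lHat G L R) ^ 2 * B * √T)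
        + 8 * α * Lt * lam ^ 2 * X.gHat G R ^ 2 /
            ((lam - X.lHat G L R) ^ 2 * B * D * √T) := by
  obtain ⟨i₀⟩ : Nonempty I := p.nonempty_of_neZero
  have hlam0 : 0 < lam := (MetaRL.lHat_nonneg hR hGL i₀).trans_lt hlam
  have hS := MetaRL.smoothBounded_J hγ hR hGL hlam hκ hlamκ
  rw [← hLt] at hS
  have hLt0 : 0 < Lt := hLt ▸ div_pos hlam0 (sub_pos.2 hκ)
  have hK := fun i => MetaRL.norm_gradient_J_le hγ hR hGL i
  have hVd := MetaRL.hasGradientAt_metaObjective p hS hJ hK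
  have hVM := MetaRL.metaObjective_mem_Icc p hS hJ
  have hVdiff : Differentiable ℝ (X.metaObjective p lam) := fun v => (hVd v).differentiableAt
  have hgc : Continuous (gradient (X.metaObjective p lam)) :=
    (LipschitzWith.of_dist_le_mul (K := ⟨Lt, hLt0.le⟩) fun x y => by
      rw [dist_eq_norm, dist_eq_norm]
      exact MetaRL.norm_gradient_metaObjective_sub_le p hS hJ hK x y).continuous
  have hw (t : ℕ) : Measurable (w t) := (hrun.adapted t).mono (ℱ.le _) le_rfl
  refine ⟨fun i => (hS i).exists_isMaxOn, hVdiff, fun t => ?_, ?_⟩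
  · refine Integrable.of_bound
      ((hgc.measurable.comp (hw t)).norm.pow_const 2).aestronglyMeasurable (X.gHat G R ^ 2)
      (Filter.Eventually.of_forall fun ω => ?_)
    rw [norm_pow, norm_norm]
    exact pow_le_pow_left₀ (norm_nonneg _)
      (MetaRL.norm_gradient_metaObjective_le p hS hJ hK _) 2
  · have hT0 : (0 : ℝ) < T := lt_of_lt_of_le (by positivity) hT
    have hs : 0 < √(T : ℝ) := Real.sqrt_pos.2 hT0
    have hα0 : 0 ≤ α := by rw [hα]; positivity
    have hsLt : 2 * Lt ≤ √(T : ℝ) := Real.le_sqrt_of_sq_le (by linarith)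
    have hαLt : α * Lt ≤ 1 := by
      rw [hα, one_div_mul_eq_div, div_le_one (by positivity)]
      linarith
    have hVi (t : ℕ) : Integrable (fun ω => X.metaObjective p lam (w t ω)) P :=
      Integrable.of_mem_Icc 0 (R / (1 - X.γ)) (hVdiff.continuous.measurable.comp (hw t)).aemeasurable
        (Filter.Eventually.of_forall fun ω => hVM _)
    have hmain := average_le_of_ascent_steps (v := fun t => ∫ ω, X.metaObjective p lam (w t ω) ∂P)
      (by exact_mod_cast hT0) hB hα hLt0.le (div_nonneg (hR.nonneg i₀) (sub_nonneg.2 hγ.2.le))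
      (fun t => ⟨integral_nonneg fun ω => (hVM _).1, by
        simpa using integral_mono (hVi t) (integrable_const _) fun ω => (hVM (w t ω)).2⟩)
      (hrun.ascent_step hγ hJ hR hGL hS hLt0.le hlam0.le hlam hν hB hD hα0 hαLt)
    -- The bound already holds without this term, so only its sign is needed.
    have hlast : 0 ≤ 8 * α * Lt * lam ^ 2 * X.gHat G R ^ 2 /
        ((lam - X.lHat G L R) ^ 2 * B * D * √T) := by positivity
    have e1 : 8 * (R / (1 - X.γ)) / √T = 8 * R / ((1 - X.γ) * √T) := by
      rw [← mul_div_assoc, div_div]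
    have e2 : (lam * ν / (lam - X.lHat G L R)) ^ 2 =
        lam ^ 2 * ν ^ 2 / (lam - X.lHat G L R) ^ 2 := by rw [div_pow, mul_pow]
    have e3 : 8 * Lt * (lam ^ 2 * ν ^ 2 / (lam - X.lHat G L R) ^ 2) / (B * √T) =
        8 * Lt * lam ^ 2 * ν ^ 2 / ((lam - X.lHat G L R) ^ 2 * B * √T) := by
      rw [← mul_div_assoc, div_div]
      ring
    rw [e1, e2, e3] at hmain
    linarith
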